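/- Let a group $G$ act by isometries on a real tree $T$ with metric $d$. For $g\in G$ put $tl(g)=\inf_{v\in T}d(v,gv)$ and $A(g)=\{v\in T: d(v,gv)=tl(g)\}$; call $g$ hyperbolic if it fixes no point of $T$ (then $A(g)$ is a line along which $g$ translates; otherwise $A(g)$ is the fixed-point set of $g$). The length $|S|\in[0,\infty]$ of a convex subset $S$ of a line is its diameter. Let $E(h)$ and $K(h)$ be the setwise and the pointwise stabilizer of $A(h)$ in $G$. A hyperbolic element $h$ is weakly stable if every $f\in G$ with $|A(h)\cap fA(h)|>tl(h)$ lies in $E(h)$; it is stable if moreover $K(h)=1$. Elements $g,h$ meet coherently if $A(g)\cap A(h)\ne\emptyset$ and, in case both are hyperbolic, their translation directions agree on $A(g)\cap A(h)$. An element $g$ inverts a segment $[p,q]$, $p\neq q$, if $gp=q$ and $gq=p$. For real $N>0$, a tuple $(a_1,\dots,a_m)\in G^m$ is weakly $N$-small cancellation, as witnessed by the base point $*\in T$, if (a) $d(*,a_i*)>N$ for all $i$; (b) $d(*,a_j*)\le\frac{N+1}{N}\min_i tl(a_i)$ for all $j$; (c) whenever $f\in G$ and $1\le i,j\le m$ satisfy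 $|[*,a_i*]\cap f[*,a_j*]|\ge\frac1N\min_l tl(a_l)$, then $i=j$ and $f$ acts as the identity on $[*,a_i*]\cap f[*,a_i*]$. It is $N$-small cancellation, as witnessed by $*$, if in addition the inequality in (c) forces $f=1$. Proposition. For every real $N\ge1$ and every integer $m\ge1$ there are an integer $K\geq 1$, positive integers $k_{i,j}$ ($1\le i\le m$, $1\le j\le K$) and words $$w^{sc}_i(x,y)=xy^{k_{i,1}}xy^{k_{i,2}}\cdots xy^{k_{i,K}}\in\mathbb F(x,y),\qquad 1\le i\le m,$$ with the following property. Let a group $G$ act by isometries on a real tree $T$, and let $g,h\in G$ be such that (i) $h$ is hyperbolic with $tl(h)\ge1$, and $h$ is stable (respectively, weakly stable); (ii) $g\notin E(h)$; (iii) $g$ and $h$ meet coherently, and $g$ does not invert a nondegenerate subsegment of $A(h)$; (iv) $tl(g)\le tl(h)$. Then the tuple $(w^{sc}_1(g,h),\dots,w^{sc}_m(g,h))$ is $N$-small cancellation (respectively, weakly $N$-small cancellation) as witnessed by any point of $A(g)\cap A(h)$, and for all $1\le i\le m$ $$tl(w^{sc}_i(g,h))\ge N\max\{tl(g),tl(h)\}=N\,tl(h).$$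 -/

import Mathlib

open scoped Pointwise

/-- A real tree: a metric space in which any two points are joined by a geodesic and which is
`0`-hyperbolic, i.e. satisfies the four-point condition. -/
structure IsRealTree (T : Type*) [MetricSpace T] : Prop where
  geodesic : ∀ x y : T, ∃ γ : ℝ → T, γ 0 = x ∧ γ (dist x y) = y ∧
    ∀ s ∈ Set.Icc (0 : ℝ) (dist x y), ∀ t ∈ Set.Icc (0 : ℝ) (dist x y),
      dist (γ s) (γ t) = |s - t|
  four_point : ∀ x y z w : T,
    dist x y + dist z w ≤ max (dist x z + dist y w) (dist x w + dist y z)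

namespace TreeAction

/-- The segment `[x, y]`. -/
def seg {T : Type*} [MetricSpace T] (x y : T) : Set T :=
  {z | dist x z + dist z y = dist x y}

/-- The length `|S| ∈ [0, ∞]` of a convex subset `S` of a line or of a segment: its diameter. -/
noncomputable def length {T : Type*} [MetricSpace T] (S : Set T) : ENNReal :=
  Metric.ediam S

section Isometries

variable {G : Type*} [Group G] (T : Type*) [MetricSpace T] [MulAction G T]

/-- The translation length `tl(g) = inf_v d(v, gv)`. -/
noncomputable def tl (g : G) : ℝ := ⨅ v : T, dist v (g • v)

/-- `g` is hyperbolic if it fixes no point. -/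
def IsHyperbolic (g : G) : Prop := ∀ v : T, g • v ≠ v

/-- The axis `A(g)`: the set of points displaced by exactly `tl(g)`. This is the fixed-point set
of an elliptic `g`, and the invariant line along which `g` translates if `g` is hyperbolic. -/
def axis (g : G) : Set T := {v | dist v (g • v) = tl T g}

/-- `E(h)`, the elements that preserve `A(h)` setwise. -/
def E (h : G) : Subgroup G := MulAction.stabilizer G (axis T h)

/-- `K(h)`, the elements that fix `A(h)` pointwise. -/
def K (h : G) : Subgroup G := fixingSubgroup G (axis T h)

/-- `h` is weakly stable: it is hyperbolic, and `|A(h) ∩ f A(h)| > tl(h)` implies `f ∈ E(h)`. -/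
def IsWeaklyStable (h : G) : Prop :=
  IsHyperbolic T h ∧
    ∀ f : G, ENNReal.ofReal (tl T h) < length (axis T h ∩ f • axis T h) → f ∈ E T h

/-- `h` is stable: it is weakly stable and `K(h) = 1`. -/
def IsStable (h : G) : Prop := IsWeaklyStable T h ∧ K T h = ⊥

/-- `g` inverts a nondegenerate subsegment of the set `S`, interchanging its two endpoints. -/
def InvertsSubsegment (g : G) (S : Set T) : Prop :=
  ∃ p q : T, p ≠ q ∧ seg p q ⊆ S ∧ g • p = q ∧ g • q = p

variable {T} in
/-- For `p` on the axis of a hyperbolic `g`: the point `q` lies on the ray of `A(g)` that starts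
at `p` and points in the translation direction of `g`. -/
def Ahead (g : G) (p q : T) : Prop := ∃ n : ℕ, q ∈ seg p (g ^ n • p)

/-- `g` and `h` meet coherently: their axes intersect and, if both are hyperbolic, their
translation directions agree on the intersection of the axes. -/
def MeetCoherently (g h : G) : Prop :=
  (axis T g ∩ axis T h).Nonempty ∧
    (IsHyperbolic T g → IsHyperbolic T h →
      ∀ p ∈ axis T g ∩ axis T h, ∀ q ∈ axis T g ∩ axis T h, Ahead g p q ↔ Ahead h p q)

variable {T} in
/-- The tuple `a` is weakly `N`-small cancellation, with `p` as base point. An overlap of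
`[p, a_i p]` with a translate of `[p, a_j p]` in which the orientations disagree is excluded as
well, since `f` has to be the identity on every long overlap. -/
def IsWeaklySmallCancellationAt (N : ℝ) {m : ℕ} (a : Fin m → G) (p : T) : Prop :=
  (∀ i, N < dist p (a i • p)) ∧
  (∀ j, dist p (a j • p) ≤ (N + 1) / N * ⨅ i, tl T (a i)) ∧
  ∀ (f : G) (i j : Fin m),
    ENNReal.ofReal (1 / N * ⨅ l, tl T (a l)) ≤
        length (seg p (a i • p) ∩ f • seg p (a j • p)) →
      i = j ∧ ∀ x ∈ seg p (a i • p) ∩ f • seg p (a j • p), f • x = x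

variable {T} in
/-- The tuple `a` is `N`-small cancellation, with `p` as base point: in addition, only `f = 1`
can produce a long overlap. -/
def IsSmallCancellationAt (N : ℝ) {m : ℕ} (a : Fin m → G) (p : T) : Prop :=
  IsWeaklySmallCancellationAt N a p ∧
  ∀ (f : G) (i j : Fin m),
    ENNReal.ofReal (1 / N * ⨅ l, tl T (a l)) ≤
        length (seg p (a i • p) ∩ f • seg p (a j • p)) →
      f = 1

end Isometries

/-- The word `x y^{k_1} x y^{k_2} ⋯ x y^{k_n}` in the free group on `x`, `y`. -/
def xyWord {n : ℕ} (k : Fin n → ℕ) : FreeGroup (Fin 2) :=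
  (List.ofFn fun j => FreeGroup.of 0 * FreeGroup.of 1 ^ k j).prod

/-- The value `w(g, h)` of a word `w(x, y)`. -/
def evalWord {G : Type*} [Group G] (g h : G) (w : FreeGroup (Fin 2)) : G :=
  FreeGroup.lift ![g, h] w

end TreeAction

open TreeAction

namespace TreeAction

/-! ### Segments in a real tree. -/

section Tree

variable {T : Type*} [MetricSpace T]

/-! Write τ for `tl T h`. A base point p on both axes lies on A(h) and is moved by g at most τ.
Since g is not in E(h), weak stability makes A(h) and gA(h) overlap in length at most τ, so they
diverge near p. Hence the path p, gp, gh^k p, … of a word is almost geodesic. It runs along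
successive translates of A(h), and after trimming 5τ at both ends of each run, the remaining cores
lie in order on the geodesic from p to wp, with gaps between τ and 11τ (`mem_seg_base`,
`core_mem_seg`). Lengths are therefore known up to bounded multiples of τ, and applying this to all
powers of a word bounds its translation length (`le_tl_pathElt`).

Now let f produce a long overlap of two such geodesics. The overlap contains two consecutive cores
of the first path. By weak stability each of them lies on an f-translate of an axis of the second
path, and the matched exponents differ by at most 26 (`exists_core_match`). All exponents are at
least 27 apart, so the words and the positions agree, and f preserves two consecutive axes.

Such an f cannot slide along the first axis: the second one branches off it in a bounded region, and
a shift would change the distances from the second axis to the two ends of the first in opposite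
ways. So f fixes an axis pointwise (`smul_eq_self_of_dist_le`, `smul_eq_self_of_core`). It is then
conjugate into K(h), hence trivial in the stable case, and in general it is the identity on the
overlap (`smul_eq_self_of_mem_overlap`). -/

theorem seg_comm (x y : T) : seg x y = seg y x := by
  ext z
  simp only [seg, Set.mem_ofPred_eq, dist_comm x z, dist_comm z y, dist_comm x y]
  constructor <;> intro h <;> linarith

theorem left_mem_seg (x y : T) : x ∈ seg x y := by simp [seg]

theorem right_mem_seg (x y : T) : y ∈ seg x y := by simp [seg]

theorem seg_trans {a b c d : T} (hb : b ∈ seg a c) (hc : c ∈ seg a d) : b ∈ seg a d := by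
  simp only [seg, Set.mem_ofPred_eq] at *
  linarith [dist_triangle a b d, dist_triangle b c d]

theorem exists_mem_seg_dist_eq (hT : IsRealTree T) (x y : T) {r : ℝ} (h0 : 0 ≤ r)
    (h1 : r ≤ dist x y) : ∃ z ∈ seg x y, dist x z = r := by
  obtain ⟨γ, hx, hy, hd⟩ := hT.geodesic x y
  have e1 := hd 0 ⟨le_rfl, dist_nonneg⟩ r ⟨h0, h1⟩
  have e2 := hd r ⟨h0, h1⟩ _ ⟨dist_nonneg, le_rfl⟩
  rw [hx, abs_of_nonpos (by linarith)] at e1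
  rw [hy, abs_of_nonpos (by linarith)] at e2
  refine ⟨γ r, ?_, by linarith⟩
  simp only [seg, Set.mem_ofPred_eq]
  linarith

/-- The four-point condition for w, z, x, y, with z on [x, y]: the geodesic from w to one of the
ends passes through z. This is the source of all convexity arguments below. -/
theorem dist_le_max_of_mem_seg (hT : IsRealTree T) {x y z : T} (hz : z ∈ seg x y) (w : T) :
    dist w z ≤ max (dist w x - dist x z) (dist w y - dist z y) := by
  have h4 := hT.four_point w z x y
  simp only [seg, Set.mem_ofPred_eq] at hz
  rw [dist_comm z x] at h4
  rcases le_max_iff.1 h4 with h | h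
  · exact le_max_of_le_left (by linarith)
  · exact le_max_of_le_right (by linarith)

/-- A point of `[a, b]` lies on `[a', b]` as soon as `a` and `a'` are on the same side of it. -/
theorem mem_seg_of_dist_lt (hT : IsRealTree T) {a a' b x : T} (hx : x ∈ seg a b)
    (h : dist a a' < dist a x + dist a' x) : x ∈ seg a' b := by
  have h4 := hT.four_point a b x a'
  simp only [seg, Set.mem_ofPred_eq] at *
  rw [dist_comm b a', dist_comm b x, dist_comm x a'] at h4
  have := dist_triangle a' x b
  rcases le_max_iff.1 h4 with h | h <;> linarith

/-- The local-to-global principle of trees: geodesics that overlap in a nondegenerate segment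
concatenate to a geodesic. -/
theorem mem_seg_of_chain (hT : IsRealTree T) {a b c d : T} (hb : b ∈ seg a c) (hc : c ∈ seg b d)
    (hbc : b ≠ c) : b ∈ seg a d ∧ c ∈ seg a d := by
  have hpos := dist_pos.2 hbc
  have h1 : b ∈ seg a d := by
    rw [seg_comm] at hb ⊢
    refine mem_seg_of_dist_lt hT hb ?_
    simp only [seg, Set.mem_ofPred_eq] at hc
    rw [dist_comm c b, dist_comm d b]
    linarith
  refine ⟨h1, ?_⟩
  simp only [seg, Set.mem_ofPred_eq] at *
  linarith

theorem dist_eq_abs_of_mem_seg (hT : IsRealTree T) {a b x y : T} (hx : x ∈ seg a b)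
    (hy : y ∈ seg a b) : dist x y = |dist a x - dist a y| := by
  have h4 := hT.four_point x y a b
  simp only [seg, Set.mem_ofPred_eq] at *
  have h1 := abs_dist_sub_le x y a
  rw [dist_comm x a, dist_comm y a] at h1
  rw [dist_comm x a, dist_comm y a] at h4
  refine le_antisymm ?_ h1
  rcases le_max_iff.1 h4 with h | h
  · linarith [le_abs_self (dist a x - dist a y)]
  · linarith [neg_abs_le (dist a x - dist a y)]

theorem mem_seg_of_dist_le (hT : IsRealTree T) {a b x y z : T} (hx : x ∈ seg a b)
    (hy : y ∈ seg a b) (hz : z ∈ seg a b) (h1 : dist a x ≤ dist a z) (h2 : dist a z ≤ dist a y) :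
    z ∈ seg x y := by
  simp only [seg, Set.mem_ofPred_eq]
  rw [dist_eq_abs_of_mem_seg hT hx hz, dist_eq_abs_of_mem_seg hT hz hy,
    dist_eq_abs_of_mem_seg hT hx hy, abs_of_nonpos (by linarith), abs_of_nonpos (by linarith),
    abs_of_nonpos (by linarith)]
  linarith

theorem seg_subset_seg (hT : IsRealTree T) {a b x y : T} (hx : x ∈ seg a b)
    (hy : y ∈ seg a b) : seg x y ⊆ seg a b := by
  intro z hz
  have h1 := dist_le_max_of_mem_seg hT hz a
  have h2 := dist_le_max_of_mem_seg hT hz b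
  have h3 := dist_eq_abs_of_mem_seg hT hx hy
  have h4 := dist_triangle a z b
  simp only [seg, Set.mem_ofPred_eq] at *
  rw [dist_comm b x, dist_comm b y, dist_comm b z] at h2
  have n1 : 0 ≤ dist x z := dist_nonneg
  have n2 : 0 ≤ dist z y := dist_nonneg
  have a1 := le_abs_self (dist a x - dist a y)
  have a2 := neg_abs_le (dist a x - dist a y)
  refine le_antisymm ?_ h4
  rcases le_max_iff.1 h1 with h1 | h1 <;> rcases le_max_iff.1 h2 with h2 | h2 <;> linarith

/-- In an interval only a reflection preserves the distance to a given point, and no reflection has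
two distinct centres. -/
theorem eq_of_dist_eq (hT : IsRealTree T) {a b x y u v : T} (hx : x ∈ seg a b)
    (hy : y ∈ seg a b) (hu : u ∈ seg a b) (hv : v ∈ seg a b) (huv : u ≠ v)
    (h1 : dist x u = dist y u) (h2 : dist x v = dist y v) : x = y := by
  rw [dist_eq_abs_of_mem_seg hT hx hu, dist_eq_abs_of_mem_seg hT hy hu] at h1
  rw [dist_eq_abs_of_mem_seg hT hx hv, dist_eq_abs_of_mem_seg hT hy hv] at h2
  have h3 := dist_pos.2 huv
  rw [dist_eq_abs_of_mem_seg hT hu hv] at h3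
  have h3' := abs_pos.1 h3
  rw [← dist_eq_zero, dist_eq_abs_of_mem_seg hT hx hy, abs_eq_zero]
  rcases abs_eq_abs.1 h1 with h1 | h1 <;> rcases abs_eq_abs.1 h2 with h2 | h2 <;>
    first
    | linarith
    | exact absurd (by linarith) h3'

/-- Two overlapping subintervals of a segment share two points whose distance is that of the
overlap. -/
theorem exists_pair_of_overlap (hT : IsRealTree T) {o e a b a' b' : T} {B B' : Set T} {τ : ℝ}
    (hB : ∀ x ∈ B, ∀ y ∈ B, seg x y ⊆ B) (hB' : ∀ x ∈ B', ∀ y ∈ B', seg x y ⊆ B')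
    (ha : a ∈ seg o e) (hb : b ∈ seg o e) (ha' : a' ∈ seg o e) (hb' : b' ∈ seg o e)
    (haB : a ∈ B) (hbB : b ∈ B) (haB' : a' ∈ B') (hbB' : b' ∈ B')
    (h0 : 0 ≤ τ)
    (h1 : dist o a + τ < dist o b) (h2 : dist o a' + τ < dist o b')
    (h3 : dist o a + τ < dist o b') (h4 : dist o a' + τ < dist o b) :
    ∃ x ∈ B ∩ B', ∃ y ∈ B ∩ B', τ < dist x y := by
  obtain ⟨x, hx, hxe, hx1⟩ : ∃ x ∈ B ∩ B', x ∈ seg o e ∧ (x = a ∨ x = a') := by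
    rcases le_total (dist o a) (dist o a') with h | h
    · exact ⟨a', ⟨hB _ haB _ hbB (mem_seg_of_dist_le hT ha hb ha' h (by linarith)), haB'⟩, ha',
        .inr rfl⟩
    · exact ⟨a, ⟨haB, hB' _ haB' _ hbB' (mem_seg_of_dist_le hT ha' hb' ha h (by linarith))⟩, ha,
        .inl rfl⟩
  obtain ⟨y, hy, hye, hy1⟩ : ∃ x ∈ B ∩ B', x ∈ seg o e ∧ (x = b ∨ x = b') := by
    rcases le_total (dist o b) (dist o b') with h | h
    · exact ⟨b, ⟨hbB, hB' _ haB' _ hbB' (mem_seg_of_dist_le hT ha' hb' hb (by linarith) h)⟩, hb,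
        .inl rfl⟩
    · exact ⟨b', ⟨hB _ haB _ hbB (mem_seg_of_dist_le hT ha hb hb' (by linarith) h), hbB'⟩, hb',
        .inr rfl⟩
  refine ⟨x, hx, y, hy, ?_⟩
  rw [dist_eq_abs_of_mem_seg hT hxe hye, abs_sub_comm]
  refine lt_of_lt_of_le ?_ (le_abs_self _)
  rcases hx1 with rfl | rfl <;> rcases hy1 with rfl | rfl <;> linarith

end Tree

/-! ### Axes of isometries and their coordinates. -/

section Axis

variable {G : Type*} [Group G] {T : Type*} [MetricSpace T] [MulAction G T]

theorem tl_le (g : G) (v : T) : tl T g ≤ dist v (g • v) :=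
  ciInf_le ⟨0, by rintro _ ⟨v, rfl⟩; exact dist_nonneg⟩ v

variable [IsIsometricSMul G T]

theorem smul_mem_seg_iff (f : G) {x y z : T} : f • z ∈ seg (f • x) (f • y) ↔ z ∈ seg x y := by
  simp [seg, dist_smul]

/-- The displacement function is convex, so its minimum set is convex. -/
theorem seg_subset_axis (hT : IsRealTree T) {h : G} {x y : T} (hx : x ∈ axis T h)
    (hy : y ∈ axis T h) : seg x y ⊆ axis T h := by
  intro z hz
  simp only [axis, Set.mem_ofPred_eq] at *
  refine le_antisymm ?_ (tl_le h z)
  have h1 := dist_le_max_of_mem_seg hT hz (h • z)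
  have h2 := dist_triangle (h • z) (h • x) x
  have h3 := dist_triangle (h • z) (h • y) y
  rw [dist_smul, dist_comm z x, dist_comm (h • x)] at h2
  rw [dist_smul, dist_comm (h • y)] at h3
  rw [dist_comm]
  rcases le_max_iff.1 h1 with h | h <;> linarith

theorem seg_subset_smul_axis (hT : IsRealTree T) {h : G} (v : G) :
    ∀ x ∈ v • axis T h, ∀ y ∈ v • axis T h, seg x y ⊆ v • axis T h := by
  intro x hx y hy z hz
  rw [Set.mem_smul_set_iff_inv_smul_mem] at *
  exact seg_subset_axis hT hx hy ((smul_mem_seg_iff _).2 hz)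

theorem zpow_smul_mem_axis {h : G} {p : T} (hp : p ∈ axis T h) (n : ℤ) :
    h ^ n • p ∈ axis T h := by
  simp only [axis, Set.mem_ofPred_eq] at *
  rw [smul_smul, (Commute.self_zpow h n).eq, ← smul_smul, dist_smul, hp]

/-- If the path p, hp, hhp backtracked at hp, the midpoint q of [p, hp] would be moved by less than
the translation length. -/
theorem dist_smul_smul_of_mem_axis (hT : IsRealTree T) {h : G} (hh : 1 ≤ tl T h) {p : T}
    (hp : p ∈ axis T h) : h • p ∈ seg p (h • h • p) := by
  have hp' : dist p (h • p) = tl T h := hp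
  have hp2 : dist (h • p) (h • h • p) = tl T h := by rw [dist_smul]; exact hp
  obtain ⟨q, hq, hq2⟩ := exists_mem_seg_dist_eq hT p (h • p) (r := tl T h / 2) (by linarith)
    (by linarith)
  have hq' : dist q (h • p) = tl T h / 2 := by
    simp only [seg, Set.mem_ofPred_eq] at hq; linarith
  have h1 := dist_le_max_of_mem_seg hT ((smul_mem_seg_iff h).2 hq) q
  have h2 := dist_le_max_of_mem_seg hT hq (h • h • p)
  have h3 := tl_le h q
  rw [dist_smul, dist_smul, hq2, hq'] at h1
  rw [hq2, hq', dist_comm _ q, dist_comm _ p, dist_comm _ (h • p), hp2] at h2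
  have h4 := dist_triangle p (h • p) (h • h • p)
  simp only [seg, Set.mem_ofPred_eq]
  rcases le_max_iff.1 h1 with h1 | h1
  · linarith
  rcases le_max_iff.1 h2 with h2 | h2 <;> linarith

theorem dist_pow_smul (hT : IsRealTree T) {h : G} (hh : 1 ≤ tl T h) {p : T}
    (hp : p ∈ axis T h) (n : ℕ) : dist p (h ^ n • p) = n * tl T h := by
  have hp' : dist p (h • p) = tl T h := hp
  have key : ∀ n : ℕ, h ^ n • p ∈ seg p (h ^ (n + 1) • p) := by
    intro n
    induction n with
    | zero => simpa using left_mem_seg p _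
    | succ n ih =>
      refine (mem_seg_of_chain hT ih (d := h ^ (n + 1 + 1) • p) ?_ ?_).2
      · have := (smul_mem_seg_iff (h ^ n)).2 (dist_smul_smul_of_mem_axis hT hh hp)
        simpa only [smul_smul, pow_succ, mul_assoc] using this
      · rw [← dist_pos, pow_succ, ← smul_smul, dist_smul, hp']
        linarith
  induction n with
  | zero => simp
  | succ n ih =>
    have := key n
    simp only [seg, Set.mem_ofPred_eq] at this
    rw [← this, ih, pow_succ, ← smul_smul, dist_smul, hp']
    push_cast; ring

theorem dist_zpow_smul (hT : IsRealTree T) {h : G} (hh : 1 ≤ tl T h) {p : T}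
    (hp : p ∈ axis T h) (a b : ℤ) : dist (h ^ a • p) (h ^ b • p) = |(a : ℝ) - b| * tl T h := by
  wlog hab : a ≤ b generalizing a b
  · rw [dist_comm, this b a (by omega), abs_sub_comm]
  obtain ⟨n, rfl⟩ := Int.le.dest hab
  rw [zpow_add, ← smul_smul, dist_smul, zpow_natCast, dist_pow_smul hT hh hp]
  push_cast
  rw [show (a : ℝ) - (a + n) = -n by ring, abs_neg, abs_of_nonneg (Nat.cast_nonneg n)]

theorem zpow_smul_mem_seg (hT : IsRealTree T) {h : G} (hh : 1 ≤ tl T h) {p : T}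
    (hp : p ∈ axis T h) {a b c : ℤ} (hb : a ≤ b ∧ b ≤ c ∨ c ≤ b ∧ b ≤ a) :
    h ^ b • p ∈ seg (h ^ a • p) (h ^ c • p) := by
  simp only [seg, Set.mem_ofPred_eq, dist_zpow_smul hT hh hp]
  rw [← add_mul]
  congr 1
  rcases hb with ⟨h1, h2⟩ | ⟨h1, h2⟩
  · have h1' : (a : ℝ) ≤ b := by exact_mod_cast h1
    have h2' : (b : ℝ) ≤ c := by exact_mod_cast h2
    rw [abs_of_nonpos (by linarith), abs_of_nonpos (by linarith), abs_of_nonpos (by linarith)]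
    ring
  · have h1' : (c : ℝ) ≤ b := by exact_mod_cast h1
    have h2' : (b : ℝ) ≤ a := by exact_mod_cast h2
    rw [abs_of_nonneg (by linarith), abs_of_nonneg (by linarith), abs_of_nonneg (by linarith)]
    ring

/-- Every point of the axis is on a long segment of the orbit of a given point of the axis. -/
theorem mem_seg_zpow (hT : IsRealTree T) {h : G} (hh : 1 ≤ tl T h) {p v : T}
    (hv : v ∈ axis T h) {n : ℕ} (hn : dist p v < n) :
    v ∈ seg (h ^ (-n : ℤ) • p) (h ^ (n : ℤ) • p) := by
  have hnn : (0 : ℝ) ≤ n := Nat.cast_nonneg n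
  have hnt : (n : ℝ) ≤ n * tl T h := le_mul_of_one_le_right hnn hh
  have h0 : v ∈ seg (h ^ (-n : ℤ) • v) (h ^ (n : ℤ) • v) := by
    simpa using zpow_smul_mem_seg hT hh hv (a := -n) (b := 0) (c := n) (by omega)
  have e1 : dist (h ^ (-n : ℤ) • v) v = n * tl T h := by
    simpa using dist_zpow_smul hT hh hv (-n) 0
  have e2 : dist (h ^ (n : ℤ) • v) v = n * tl T h := by
    simpa using dist_zpow_smul hT hh hv n 0
  have h1 : v ∈ seg (h ^ (-n : ℤ) • p) (h ^ (n : ℤ) • v) := by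
    refine mem_seg_of_dist_lt hT h0 ?_
    rw [dist_smul, dist_comm v p, e1]
    linarith [dist_nonneg (x := h ^ (-n : ℤ) • p) (y := v)]
  rw [seg_comm] at h1 ⊢
  refine mem_seg_of_dist_lt hT h1 ?_
  rw [dist_smul, dist_comm v p, e2]
  linarith [dist_nonneg (x := h ^ (n : ℤ) • p) (y := v)]

/-- The axis embeds isometrically in the real line. -/
theorem exists_axis_coordinate (hT : IsRealTree T) {h : G} (hh : 1 ≤ tl T h) {p : T}
    (hp : p ∈ axis T h) :
    ∃ b : T → ℝ, (∀ u ∈ axis T h, ∀ v ∈ axis T h, dist u v = |b u - b v|) ∧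
      ∀ k : ℤ, b (h ^ k • p) = k * tl T h := by
  let ν : T → ℕ := fun v => ⌊dist p v⌋₊ + 1
  have hν : ∀ v, dist p v < ν v := fun v => by
    simpa [ν] using Nat.lt_floor_add_one (dist p v)
  -- A Busemann function for the repelling end of the axis. Starting further back along the orbit of
  -- p does not change the value, so any two points can be compared from a common start.
  let b : T → ℝ := fun v => dist (h ^ (-(ν v : ℤ)) • p) v - ν v * tl T h
  have hb : ∀ v ∈ axis T h, ∀ n : ℕ, ν v ≤ n →
      b v = dist (h ^ (-(n : ℤ)) • p) v - n * tl T h := by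
    intro v hv n hn
    have hn' : (ν v : ℝ) ≤ n := by exact_mod_cast hn
    have hs := mem_seg_zpow hT hh hv (hν v)
    have h1 : h ^ (-(ν v : ℤ)) • p ∈ seg (h ^ (-(n : ℤ)) • p) (h ^ (ν v : ℤ) • p) :=
      zpow_smul_mem_seg hT hh hp (by omega)
    have h2 : h ^ (-(ν v : ℤ)) • p ∈ seg (h ^ (-(n : ℤ)) • p) v := by
      simp only [seg, Set.mem_ofPred_eq] at *
      linarith [dist_triangle (h ^ (-(n : ℤ)) • p) v (h ^ (ν v : ℤ) • p),
        dist_triangle (h ^ (-(n : ℤ)) • p) (h ^ (-(ν v : ℤ)) • p) v]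
    have h3 := dist_zpow_smul hT hh hp (-(n : ℤ)) (-(ν v : ℤ))
    push_cast at h3
    rw [abs_of_nonpos (by linarith)] at h3
    simp only [seg, Set.mem_ofPred_eq] at h2
    simp only [b]
    rw [← h2, h3]
    ring
  refine ⟨b, ?_, ?_⟩
  · intro u hu v hv
    let n := max (ν u) (ν v)
    have hun : dist p u < n := (hν u).trans_le (by exact_mod_cast le_max_left _ _)
    have hvn : dist p v < n := (hν v).trans_le (by exact_mod_cast le_max_right _ _)
    rw [hb u hu n (le_max_left _ _), hb v hv n (le_max_right _ _),
      dist_eq_abs_of_mem_seg hT (mem_seg_zpow hT hh hu hun) (mem_seg_zpow hT hh hv hvn)]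
    congr 1
    ring
  · intro k
    let n := max (ν (h ^ k • p)) k.natAbs
    have hk : (-(n : ℝ)) ≤ k := by
      have h1 : k.natAbs ≤ n := le_max_right _ _
      have h2 : -(n : ℤ) ≤ k := by omega
      exact_mod_cast h2
    rw [hb _ (zpow_smul_mem_axis hp k) n (le_max_left _ _), dist_zpow_smul hT hh hp]
    push_cast
    rw [abs_of_nonpos (by linarith)]
    ring

end Axis

/-! ### Prefixes of the words and their periodic extension. -/

section Words

variable {G : Type*} [Group G]

/-- The prefixes `x y^{k_0} x y^{k_1} ⋯ x y^{k_{n-1}}`, evaluated at `(g, h)`. -/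
def pathElt (g h : G) (κ : ℕ → ℕ) : ℕ → G
  | 0 => 1
  | n + 1 => pathElt g h κ n * g * h ^ κ n

theorem pathElt_add (g h : G) (κ : ℕ → ℕ) (a b : ℕ) :
    pathElt g h κ (a + b) = pathElt g h κ a * pathElt g h (fun n => κ (a + n)) b := by
  induction b with
  | zero => simp [pathElt]
  | succ b ih => rw [← add_assoc, pathElt, ih, pathElt]; simp only [mul_assoc]

theorem pathElt_mul_period (g h : G) {κ : ℕ → ℕ} {q : ℕ} (hκ : ∀ n, κ (q + n) = κ n) (n : ℕ) :
    pathElt g h κ (n * q) = pathElt g h κ q ^ n := by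
  induction n with
  | zero => simp [pathElt]
  | succ n ih =>
    rw [Nat.succ_mul, add_comm, pathElt_add, funext hκ, ih, pow_succ']

theorem evalWord_xyWord (g h : G) (κ : ℕ → ℕ) (n : ℕ) :
    evalWord g h (xyWord fun j : Fin n => κ j) = pathElt g h κ n := by
  induction n with
  | zero => simp [evalWord, xyWord, pathElt]
  | succ n ih =>
    rw [pathElt, ← ih, evalWord, evalWord, xyWord, xyWord, List.ofFn_succ']
    simp [List.concat_eq_append, mul_assoc]

end Words

/-! ### Divergence of A(h) and gA(h). -/

section Transverse

variable {G : Type*} [Group G] (T : Type*) [MetricSpace T] [MulAction G T]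

/-- The axes of `h` and of its conjugate by `g` diverge at bounded distance from the point `p` of
the axis of `h`. -/
structure IsTransverseAt (g h : G) (p : T) : Prop where
  isRealTree : IsRealTree T
  one_le : 1 ≤ tl T h
  isWeaklyStable : IsWeaklyStable T h
  notMem : g ∉ E T h
  mem_axis : p ∈ axis T h
  dist_le : dist p (g • p) ≤ tl T h

variable {T} [IsIsometricSMul G T] {g h : G} {p : T}

/-- Translating by v⁻¹ reduces this to the definition of weak stability. In this form it serves to
identify the axes met by different paths. -/
theorem IsWeaklyStable.smul_axis_eq (hs : IsWeaklyStable T h) {v v' : G} {x y : T}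
    (hx : x ∈ v • axis T h ∩ v' • axis T h) (hy : y ∈ v • axis T h ∩ v' • axis T h)
    (hxy : tl T h < dist x y) : v • axis T h = v' • axis T h := by
  have h1 : v⁻¹ * v' ∈ E T h := by
    refine hs.2 _ (lt_of_lt_of_le ?_ (Metric.edist_le_ediam_of_mem (x := v⁻¹ • x) (y := v⁻¹ • y)
      ?_ ?_))
    · rw [edist_dist, dist_smul]
      exact (ENNReal.ofReal_lt_ofReal_iff_of_nonneg
        (Real.iInf_nonneg fun _ => dist_nonneg)).2 hxy
    · rw [mul_smul, ← Set.mem_smul_set_iff_inv_smul_mem]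
      simpa [Set.smul_set_inter] using hx
    · rw [mul_smul, ← Set.mem_smul_set_iff_inv_smul_mem]
      simpa [Set.smul_set_inter] using hy
  have h2 : (v⁻¹ * v') • axis T h = axis T h := h1
  rw [← h2, smul_smul, mul_inv_cancel_left, h2]

theorem IsTransverseAt.symm (s : IsTransverseAt T g h p) : IsTransverseAt T g⁻¹ h p where
  isRealTree := s.isRealTree
  one_le := s.one_le
  isWeaklyStable := s.isWeaklyStable
  notMem := fun h => s.notMem (by simpa using inv_mem h)
  mem_axis := s.mem_axis
  dist_le := by
    have := s.dist_le
    rwa [← dist_smul g, smul_inv_smul, dist_comm]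

/-- The segment from a point of `gA(h)` to a far away point of `A(h)` runs along `A(h)` outside a
neighbourhood of the base point. -/
theorem IsTransverseAt.mem_seg_of_far (s : IsTransverseAt T g h p) {x y q : T}
    (hy : y ∈ axis T h) (hx : x ∈ seg p y) (hd : 4 * tl T h ≤ dist p x)
    (hq : q ∈ g • axis T h) : x ∈ seg y q := by
  have hT := s.isRealTree
  have h1 := s.one_le
  -- Otherwise x lies on [p, q]. Beyond distance 2τ from p that segment is in gA(h), because gp is
  -- within τ of p. Then [x', x], of length at least 2τ, lies in both axes, which forces g ∈ E(h).
  by_contra hn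
  have hxA : x ∈ axis T h := seg_subset_axis hT s.mem_axis hy hx
  have hxpq : x ∈ seg p q := by
    have h4 := hT.four_point p y x q
    simp only [seg, Set.mem_ofPred_eq] at *
    have t1 := dist_triangle y x q
    have t2 := dist_triangle p x q
    have t3 := dist_comm y x
    rcases le_max_iff.1 h4 with h | h
    · exact absurd (by linarith) hn
    · linarith
  obtain ⟨x', hx', hd'⟩ := exists_mem_seg_dist_eq hT p x (r := 2 * tl T h) (by linarith)
    (by linarith)
  have hgp : g • p ∈ g • axis T h := Set.smul_mem_smul_set s.mem_axis
  have hle := s.dist_le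
  have key : ∀ z ∈ seg p q, 2 * tl T h ≤ dist p z → z ∈ g • axis T h := by
    intro z hz hzd
    refine seg_subset_smul_axis hT g _ hgp _ hq (mem_seg_of_dist_lt hT hz ?_)
    linarith [dist_triangle p (g • p) z]
  have hx'A : x' ∈ axis T h := seg_subset_axis hT s.mem_axis hxA hx'
  refine s.notMem (show g • axis T h = axis T h from ?_)
  have := s.isWeaklyStable.smul_axis_eq (v := g) (v' := 1) (x := x) (y := x')
    ⟨key x hxpq (by linarith), by simpa using hxA⟩
    ⟨key x' (seg_trans hx' hxpq) (by linarith), by simpa using hx'A⟩ ?_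
  · simpa using this
  · simp only [seg, Set.mem_ofPred_eq] at hx'
    rw [dist_comm]
    linarith

theorem IsTransverseAt.mem_seg_of_far' (s : IsTransverseAt T g h p) {x y q : T}
    (hy : y ∈ axis T h) (hx : x ∈ seg p y) (hd : 4 * tl T h ≤ dist p x)
    (hq : q ∈ axis T h) : g • x ∈ seg q (g • y) := by
  have := (smul_mem_seg_iff g).2 (s.symm.mem_seg_of_far hy hx hd (Set.smul_mem_smul_set hq))
  rwa [smul_inv_smul, seg_comm] at this

theorem IsTransverseAt.zpow_mem_seg (s : IsTransverseAt T g h p) {a b : ℤ} {q : T}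
    (hab : 4 ≤ a ∧ a ≤ b ∨ a ≤ -4 ∧ b ≤ a) (hq : q ∈ g • axis T h) :
    h ^ a • p ∈ seg (h ^ b • p) q := by
  refine s.mem_seg_of_far (zpow_smul_mem_axis s.mem_axis b) ?_ ?_ hq
  · simpa using zpow_smul_mem_seg s.isRealTree s.one_le s.mem_axis (a := 0) (b := a) (c := b)
      (by omega)
  · have := dist_zpow_smul s.isRealTree s.one_le s.mem_axis 0 a
    simp only [zpow_zero, one_smul, Int.cast_zero, zero_sub, abs_neg] at this
    rw [this]
    refine mul_le_mul_of_nonneg_right ?_ (by linarith [s.one_le])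
    have : 4 ≤ |a| := by rw [le_abs]; omega
    exact_mod_cast this

theorem IsTransverseAt.smul_zpow_mem_seg (s : IsTransverseAt T g h p) {a b : ℤ} {q : T}
    (hab : 4 ≤ a ∧ a ≤ b ∨ a ≤ -4 ∧ b ≤ a) (hq : q ∈ axis T h) :
    g • h ^ a • p ∈ seg q (g • h ^ b • p) := by
  have := (smul_mem_seg_iff g).2 (s.symm.zpow_mem_seg hab (Set.smul_mem_smul_set hq))
  rwa [smul_inv_smul, seg_comm] at this

/-- An element that moves some points of `A(h)` and of `gA(h)` only a little, and maps them into
the same axes, fixes `A(h)` pointwise. -/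
theorem IsTransverseAt.smul_eq_self_of_dist_le (s : IsTransverseAt T g h p) {e : G} {y y' z : T}
    (he : e • axis T h = axis T h) (hy : y ∈ axis T h) (hy' : y' ∈ axis T h)
    (hz : z ∈ g • axis T h) (hez : e • z ∈ g • axis T h)
    (hyd : dist y (e • y) ≤ 13 * tl T h) (hyd' : dist y' (e • y') ≤ 13 * tl T h)
    (hyy : 26 * tl T h < dist y y')
    (hw : g • h ^ (4 : ℤ) • p ∈ seg (g • p) z) (hw' : g • h ^ (4 : ℤ) • p ∈ seg (g • p) (e • z)) :
    ∀ v ∈ axis T h, e • v = v := by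
  have hT := s.isRealTree
  have h1 := s.one_le
  have hmap : ∀ v ∈ axis T h, e • v ∈ axis T h := fun v hv => by
    rw [← he]; exact Set.smul_mem_smul_set hv
  obtain ⟨b, hb, hbk⟩ := exists_axis_coordinate hT h1 s.mem_axis
  have hbp : b p = 0 := by simpa using hbk 0
  -- In the coordinate b, e is a translation or a reflection. A reflection cannot move two points
  -- more than 26τ apart by at most 13τ each.
  obtain ⟨δ, hδ⟩ : ∃ δ, ∀ v ∈ axis T h, b (e • v) = b v + δ := by
    refine ⟨b (e • y) - b y, fun v hv => ?_⟩
    have a1 := hb _ hy _ hy'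
    have a2 := hb _ (hmap _ hy) _ (hmap _ hy')
    have a3 := hb _ hy _ (hmap _ hy)
    have a4 := hb _ hy' _ (hmap _ hy')
    have a5 := hb _ hv _ hy
    have a6 := hb _ hv _ hy'
    have a7 := hb _ (hmap _ hv) _ (hmap _ hy)
    have a8 := hb _ (hmap _ hv) _ (hmap _ hy')
    rw [dist_smul] at a2 a7 a8
    rw [a1] at hyy a2
    rw [a3] at hyd
    rw [a4] at hyd'
    rw [a5] at a7
    rw [a6] at a8
    obtain ⟨c1, c2⟩ := abs_le.1 hyd
    obtain ⟨c3, c4⟩ := abs_le.1 hyd'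
    rcases abs_eq_abs.1 a2 with a2 | a2
    · rcases abs_eq_abs.1 a7 with a7 | a7
      · linarith
      · rcases abs_eq_abs.1 a8 with a8 | a8
        · linarith
        · have : b y - b y' = 0 := by linarith
          rw [this, abs_zero] at hyy
          linarith
    · rcases lt_abs.1 hyy with hyy | hyy <;> linarith
  set w := g • h ^ (4 : ℤ) • p with hwdef
  have hwA : w ∈ g • axis T h := Set.smul_mem_smul_set (zpow_smul_mem_axis s.mem_axis 4)
  have hfar : ∀ u ∈ axis T h, ∀ x ∈ g • axis T h, w ∈ seg (g • p) x →
      dist x u = dist x w + dist w u := by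
    intro u hu x hx hwx
    obtain ⟨x, hx0, rfl⟩ := hx
    have hx1 := (smul_mem_seg_iff g).1 hwx
    have := s.mem_seg_of_far' hx0 hx1 ?_ hu
    · rw [seg_comm] at this
      exact this.symm
    · have := dist_zpow_smul hT h1 s.mem_axis 0 4
      norm_num at this
      have h4 : h ^ (4 : ℤ) = h ^ (4 : ℕ) := by norm_cast
      rw [h4, this]
  have hx4 : ∀ k : ℤ, h ^ k • p ∈ axis T h := zpow_smul_mem_axis s.mem_axis
  have hb4 := hbk 4
  have hb4' := hbk (-4)
  push_cast at hb4 hb4'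
  have hright : ∀ u ∈ axis T h, 4 * tl T h ≤ b u →
      dist w u = dist w (h ^ (4 : ℤ) • p) + (b u - 4 * tl T h) := by
    intro u hu hbu
    have e1 := hb _ s.mem_axis _ (hx4 4)
    have e2 := hb _ (hx4 4) _ hu
    have e3 := hb _ s.mem_axis _ hu
    rw [hbp, hb4, abs_of_nonpos (by linarith)] at e1
    rw [hb4, abs_of_nonpos (by linarith)] at e2
    rw [hbp, abs_of_nonpos (by linarith)] at e3
    have := s.mem_seg_of_far hu (x := h ^ (4 : ℤ) • p) (by
      simp only [seg, Set.mem_ofPred_eq]; linarith) (by linarith) hwA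
    simp only [seg, Set.mem_ofPred_eq] at this
    rw [dist_comm w u, dist_comm w, ← this, dist_comm u, e2]
    ring
  have hleft : ∀ u ∈ axis T h, b u ≤ -4 * tl T h →
      dist w u = dist w (h ^ (-4 : ℤ) • p) + (-4 * tl T h - b u) := by
    intro u hu hbu
    have e1 := hb _ s.mem_axis _ (hx4 (-4))
    have e2 := hb _ (hx4 (-4)) _ hu
    have e3 := hb _ s.mem_axis _ hu
    rw [hbp, hb4', abs_of_nonneg (by linarith)] at e1
    rw [hb4', abs_of_nonneg (by linarith)] at e2
    rw [hbp, abs_of_nonneg (by linarith)] at e3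
    have := s.mem_seg_of_far hu (x := h ^ (-4 : ℤ) • p) (by
      simp only [seg, Set.mem_ofPred_eq]; linarith) (by linarith) hwA
    simp only [seg, Set.mem_ofPred_eq] at this
    rw [dist_comm w u, dist_comm w, ← this, dist_comm u, e2]
    ring
  -- Geodesics from z and from ez to A(h) pass through w. Comparing distances to far points on the
  -- right gives d(ez, w) - d(z, w) = -δ, and on the left +δ. The exponents ±20 leave room: after a
  -- shift by at most 13τ the points are still more than 4τ from p.
  have hδ0 : δ = 0 := by
    have hδy := hδ y hy
    have hyd1 := hb _ hy _ (hmap _ hy)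
    rw [hyd1, hδy] at hyd
    obtain ⟨c1, c2⟩ := abs_le.1 hyd
    have b1 := hbk 20
    have b2 := hbk (-20)
    push_cast at b1 b2
    have d1 := hδ _ (hx4 20)
    have d2 := hδ _ (hx4 (-20))
    have r1 := hright _ (hx4 20) (by linarith)
    have r2 := hright _ (hmap _ (hx4 20)) (by linarith)
    have l1 := hleft _ (hx4 (-20)) (by linarith)
    have l2 := hleft _ (hmap _ (hx4 (-20))) (by linarith)
    have f1 := hfar _ (hx4 20) _ hz hw
    have f2 := hfar _ (hmap _ (hx4 20)) _ hez hw'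
    have f3 := hfar _ (hx4 (-20)) _ hz hw
    have f4 := hfar _ (hmap _ (hx4 (-20))) _ hez hw'
    rw [dist_smul] at f2 f4
    linarith
  intro v hv
  rw [← dist_eq_zero, hb _ (hmap _ hv) _ hv, hδ v hv, hδ0, add_zero, sub_self, abs_zero]

end Transverse

/-- A trichotomy on an interval: a point outside [s, t] is separated from c by s or by t. It is used
to confine a matched core to the overlap. -/
theorem mem_seg_or_mem_seg {T : Type*} [MetricSpace T] (hT : IsRealTree T) {o x s t c e : T}
    (hs : s ∈ seg o x) (ht : t ∈ seg o x) (hc : c ∈ seg s t) (he : e ∈ seg o x) :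
    e ∈ seg s t ∨ s ∈ seg c e ∨ t ∈ seg c e := by
  wlog hst : dist o s ≤ dist o t generalizing s t
  · rw [seg_comm] at hc
    have := this ht hs hc (by linarith)
    rw [seg_comm s t]
    tauto
  have hc' := seg_subset_seg hT hs ht hc
  have h1 := dist_eq_abs_of_mem_seg hT hs hc'
  have h2 := dist_eq_abs_of_mem_seg hT hc' ht
  have h3 := dist_eq_abs_of_mem_seg hT hs ht
  have h4 : dist s c + dist c t = dist s t := hc
  have h5 := abs_of_nonpos (sub_nonpos.2 hst)
  have h6 := le_abs_self (dist o s - dist o c)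
  have h7 := neg_abs_le (dist o s - dist o c)
  have h8 := le_abs_self (dist o c - dist o t)
  have h9 := neg_abs_le (dist o c - dist o t)
  rcases le_total (dist o e) (dist o s) with h | h
  · right; left
    rw [seg_comm]
    exact mem_seg_of_dist_le hT he hc' hs h (by linarith)
  rcases le_total (dist o t) (dist o e) with h' | h'
  · right; right
    exact mem_seg_of_dist_le hT hc' he ht (by linarith) h'
  · left
    exact mem_seg_of_dist_le hT hs ht he h h'

/-! ### The geodesic of a word and its cores. -/

section Path

variable {G : Type*} [Group G] {T : Type*} [MulAction G T]

/-- The point where the path of a word enters the `l`-th translate of `A(h)` for good. -/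
def coreIn (g h : G) (p : T) (κ : ℕ → ℕ) (l : ℕ) : T :=
  pathElt g h κ l • g • h ^ (5 : ℤ) • p

/-- A point close to which the path of a word leaves the `l`-th translate of `A(h)`. -/
def coreOut (g h : G) (p : T) (κ : ℕ → ℕ) (l : ℕ) : T :=
  pathElt g h κ l • g • h ^ ((κ l : ℤ) - 5) • p

theorem coreOut_eq (g h : G) (p : T) (κ : ℕ → ℕ) (l : ℕ) :
    coreOut g h p κ l = pathElt g h κ (l + 1) • h ^ (-5 : ℤ) • p := by
  rw [coreOut, pathElt, ← zpow_natCast, sub_eq_add_neg, zpow_add]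
  simp only [mul_smul]

theorem coreIn_eq (g h : G) (p : T) (κ : ℕ → ℕ) (l : ℕ) :
    coreIn g h p κ l = pathElt g h κ (l + 1) • h ^ (5 - (κ l : ℤ)) • p := by
  rw [coreIn, pathElt, ← zpow_natCast]
  simp only [mul_smul, smul_smul (h ^ (_ : ℤ)) (h ^ (_ : ℤ)), ← zpow_add]
  congr 4
  ring

variable [MetricSpace T]

/-- The `l`-th translate of `A(h)` along which the path of a word runs. -/
def coreAxis (T : Type*) [MetricSpace T] [MulAction G T] (g h : G) (κ : ℕ → ℕ) (l : ℕ) : Set T :=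
  (pathElt g h κ l * g) • axis T h

theorem zpow_smul_axis (h : G) [IsIsometricSMul G T] (n : ℤ) : h ^ n • axis T h = axis T h := by
  ext z
  rw [Set.mem_smul_set_iff_inv_smul_mem]
  constructor
  · intro hz
    simpa using zpow_smul_mem_axis hz n
  · intro hz
    rw [← zpow_neg]
    exact zpow_smul_mem_axis hz _

variable [IsIsometricSMul G T]

theorem coreAxis_eq (g h : G) (κ : ℕ → ℕ) (l : ℕ) :
    coreAxis T g h κ l = pathElt g h κ (l + 1) • axis T h := by
  rw [coreAxis, pathElt, mul_smul _ (h ^ _), ← zpow_natCast, zpow_smul_axis]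

variable {g h : G} {p : T} {κ : ℕ → ℕ}

namespace IsTransverseAt

theorem coreIn_mem (s : IsTransverseAt T g h p) (l : ℕ) :
    coreIn g h p κ l ∈ coreAxis T g h κ l := by
  rw [coreIn, coreAxis, ← mul_smul]
  exact Set.smul_mem_smul_set (zpow_smul_mem_axis s.mem_axis _)

theorem coreOut_mem (s : IsTransverseAt T g h p) (l : ℕ) :
    coreOut g h p κ l ∈ coreAxis T g h κ l := by
  rw [coreOut, coreAxis, ← mul_smul]
  exact Set.smul_mem_smul_set (zpow_smul_mem_axis s.mem_axis _)

theorem coreAxis_succ_ne (s : IsTransverseAt T g h p) (l : ℕ) :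
    coreAxis T g h κ l ≠ coreAxis T g h κ (l + 1) := by
  intro he
  rw [coreAxis_eq, coreAxis, mul_smul] at he
  exact s.notMem (smul_left_cancel _ he).symm

theorem dist_coreIn_coreOut (s : IsTransverseAt T g h p) (hκ : ∀ n, 60 ≤ κ n) (l : ℕ) :
    dist (coreIn g h p κ l) (coreOut g h p κ l) = (κ l - 10) * tl T h := by
  rw [coreIn, coreOut, dist_smul, dist_smul, dist_zpow_smul s.isRealTree s.one_le s.mem_axis]
  have : (60 : ℝ) ≤ κ l := by exact_mod_cast hκ l
  push_cast
  rw [abs_of_nonpos (by linarith)]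
  ring

/-- The two trimmed ends contribute 5τ each, and the displacement of p by g at most τ. -/
theorem dist_coreOut_coreIn_le (s : IsTransverseAt T g h p) (l : ℕ) :
    dist (coreOut g h p κ l) (coreIn g h p κ (l + 1)) ≤ 11 * tl T h := by
  rw [coreIn, coreOut_eq, dist_smul]
  have h1 := dist_zpow_smul s.isRealTree s.one_le s.mem_axis (-5) 0
  have h2 := dist_zpow_smul s.isRealTree s.one_le s.mem_axis 0 5
  have h3 := dist_triangle4 (h ^ (-5 : ℤ) • p) p (g • p) (g • h ^ (5 : ℤ) • p)
  have h4 := s.dist_le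
  rw [dist_smul] at h3
  simp only [zpow_zero, one_smul] at h1 h2
  norm_num at h1 h2 h3 ⊢
  linarith

theorem le_dist_coreOut_coreIn (s : IsTransverseAt T g h p) (l : ℕ) :
    tl T h ≤ dist (coreOut g h p κ l) (coreIn g h p κ (l + 1)) := by
  rw [coreIn, coreOut_eq, dist_smul]
  have h1 := s.zpow_mem_seg (a := -4) (b := -5) (by omega)
    (Set.smul_mem_smul_set (zpow_smul_mem_axis s.mem_axis 5))
  have h2 := dist_zpow_smul s.isRealTree s.one_le s.mem_axis (-5) (-4)
  rw [seg, Set.mem_ofPred_eq, h2] at h1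
  rw [← h1]
  norm_num

theorem coreOut_mem_seg (s : IsTransverseAt T g h p) (hκ : ∀ n, 60 ≤ κ n) (l : ℕ) :
    coreOut g h p κ l ∈ seg (coreIn g h p κ l) (coreIn g h p κ (l + 1)) := by
  rw [coreOut_eq, coreIn_eq, coreIn, smul_mem_seg_iff]
  have := hκ l
  exact s.zpow_mem_seg (by omega) (Set.smul_mem_smul_set (zpow_smul_mem_axis s.mem_axis 5))

theorem coreIn_mem_seg (s : IsTransverseAt T g h p) (hκ : ∀ n, 60 ≤ κ n) (l : ℕ) :
    coreIn g h p κ (l + 1) ∈ seg (coreOut g h p κ l) (coreOut g h p κ (l + 1)) := by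
  rw [coreOut_eq, coreOut, coreIn, smul_mem_seg_iff]
  have := hκ (l + 1)
  exact s.smul_zpow_mem_seg (by omega) (zpow_smul_mem_axis s.mem_axis _)

theorem coreIn_ne_coreOut (s : IsTransverseAt T g h p) (hκ : ∀ n, 60 ≤ κ n) (l : ℕ) :
    coreIn g h p κ l ≠ coreOut g h p κ l := by
  rw [← dist_pos, s.dist_coreIn_coreOut hκ]
  have : (60 : ℝ) ≤ κ l := by exact_mod_cast hκ l
  have := s.one_le
  apply mul_pos <;> linarith

/-- Induction along the path: cores and gaps are nondegenerate and each consecutive pair is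
geodesic, so `mem_seg_of_chain` extends the geodesic from p. -/
theorem mem_seg_base (s : IsTransverseAt T g h p) (hκ : ∀ n, 60 ≤ κ n) (l : ℕ) :
    coreIn g h p κ l ∈ seg p (coreOut g h p κ l) ∧
      coreOut g h p κ l ∈ seg p (coreIn g h p κ (l + 1)) := by
  have key : ∀ l, coreIn g h p κ l ∈ seg p (coreOut g h p κ l) →
      coreOut g h p κ l ∈ seg p (coreIn g h p κ (l + 1)) := fun l hl =>
    (mem_seg_of_chain s.isRealTree hl (s.coreOut_mem_seg hκ l) (s.coreIn_ne_coreOut hκ l)).2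
  suffices coreIn g h p κ l ∈ seg p (coreOut g h p κ l) from ⟨this, key l this⟩
  induction l with
  | zero =>
    have := hκ 0
    rw [coreIn, coreOut, pathElt, one_smul, one_smul]
    exact s.smul_zpow_mem_seg (by omega) s.mem_axis
  | succ l ih =>
    refine (mem_seg_of_chain s.isRealTree (key l ih) (s.coreIn_mem_seg hκ l) ?_).2
    rw [← dist_pos]
    linarith [s.le_dist_coreOut_coreIn (κ := κ) l, s.one_le]

theorem dist_base_coreOut (s : IsTransverseAt T g h p) (hκ : ∀ n, 60 ≤ κ n) (l : ℕ) :
    dist p (coreOut g h p κ l) = dist p (coreIn g h p κ l) + (κ l - 10) * tl T h := by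
  rw [← s.dist_coreIn_coreOut hκ, (s.mem_seg_base hκ l).1]

theorem dist_base_coreIn_succ (s : IsTransverseAt T g h p) (hκ : ∀ n, 60 ≤ κ n) (l : ℕ) :
    dist p (coreOut g h p κ l) + tl T h ≤ dist p (coreIn g h p κ (l + 1)) ∧
      dist p (coreIn g h p κ (l + 1)) ≤ dist p (coreOut g h p κ l) + 11 * tl T h := by
  rw [← (s.mem_seg_base hκ l).2]
  constructor <;> linarith [s.le_dist_coreOut_coreIn (κ := κ) l,
    s.dist_coreOut_coreIn_le (κ := κ) l]

theorem dist_base_coreIn_zero (s : IsTransverseAt T g h p) :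
    dist p (coreIn g h p κ 0) ≤ 6 * tl T h := by
  rw [coreIn, pathElt, one_smul]
  have h2 := dist_zpow_smul s.isRealTree s.one_le s.mem_axis 0 5
  have h3 := dist_triangle p (g • p) (g • h ^ (5 : ℤ) • p)
  have h4 := s.dist_le
  rw [dist_smul] at h3
  simp only [zpow_zero, one_smul] at h2
  norm_num at h2 h3 ⊢
  linarith

theorem coreOut_mem_seg_end (s : IsTransverseAt T g h p) (hκ : ∀ n, 60 ≤ κ n) (l : ℕ) :
    coreOut g h p κ l ∈ seg p (pathElt g h κ (l + 1) • p) := by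
  refine (mem_seg_of_chain s.isRealTree (s.mem_seg_base hκ l).1 ?_ (s.coreIn_ne_coreOut hκ l)).2
  rw [coreOut_eq, coreIn_eq, smul_mem_seg_iff]
  have := hκ l
  simpa using zpow_smul_mem_seg s.isRealTree s.one_le s.mem_axis (a := 5 - (κ l : ℤ)) (b := -5)
    (c := 0) (by omega)

theorem dist_base_end (s : IsTransverseAt T g h p) (hκ : ∀ n, 60 ≤ κ n) (l : ℕ) :
    dist p (pathElt g h κ (l + 1) • p) = dist p (coreOut g h p κ l) + 5 * tl T h := by
  rw [← s.coreOut_mem_seg_end hκ l, coreOut_eq, dist_smul]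
  have := dist_zpow_smul s.isRealTree s.one_le s.mem_axis (-5) 0
  simp only [zpow_zero, one_smul] at this
  norm_num at this ⊢
  exact this

theorem core_mem_seg (s : IsTransverseAt T g h p) (hκ : ∀ n, 60 ≤ κ n) {l n : ℕ} (hl : l < n) :
    coreIn g h p κ l ∈ seg p (pathElt g h κ n • p) ∧
      coreOut g h p κ l ∈ seg p (pathElt g h κ n • p) := by
  suffices coreOut g h p κ l ∈ seg p (pathElt g h κ n • p) from
    ⟨seg_trans (s.mem_seg_base hκ l).1 this, this⟩
  obtain ⟨n, rfl⟩ : ∃ k, n = k + 1 := ⟨n - 1, by omega⟩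
  refine seg_trans ?_ (s.coreOut_mem_seg_end hκ n)
  obtain ⟨k, rfl⟩ := Nat.exists_eq_add_of_le (Nat.lt_succ_iff.1 hl)
  clear hl
  induction k with
  | zero => exact right_mem_seg _ _
  | succ k ih =>
    exact seg_trans ih (seg_trans (s.mem_seg_base hκ (l + k)).2 (s.mem_seg_base hκ (l + k + 1)).1)

theorem core_length (s : IsTransverseAt T g h p) (hκ : ∀ n, 60 ≤ κ n) (l : ℕ) :
    dist p (coreIn g h p κ l) + 50 * tl T h ≤ dist p (coreOut g h p κ l) := by
  rw [s.dist_base_coreOut hκ]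
  have : (60 : ℝ) ≤ κ l := by exact_mod_cast hκ l
  have := s.one_le
  nlinarith

/-- The inequalities say that [a, b] and the core, as intervals of one geodesic, overlap in more
than τ; weak stability then identifies the axes. -/
theorem smul_axis_eq_coreAxis (s : IsTransverseAt T g h p) (hκ : ∀ n, 60 ≤ κ n) {l n : ℕ}
    (hl : l < n) {v : G} {a b : T}
    (ha : a ∈ seg p (pathElt g h κ n • p)) (hb : b ∈ seg p (pathElt g h κ n • p))
    (hav : a ∈ v • axis T h) (hbv : b ∈ v • axis T h)
    (hab : dist p a + tl T h < dist p b)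
    (h1 : dist p a + tl T h < dist p (coreOut g h p κ l))
    (h2 : dist p (coreIn g h p κ l) + tl T h < dist p b) :
    v • axis T h = coreAxis T g h κ l := by
  have hτ := s.one_le
  obtain ⟨x, hx, y, hy, hxy⟩ := exists_pair_of_overlap s.isRealTree (B := v • axis T h)
    (B' := coreAxis T g h κ l) (τ := tl T h)
    (seg_subset_smul_axis s.isRealTree v) (seg_subset_smul_axis s.isRealTree _) ha hb
    (s.core_mem_seg hκ hl).1 (s.core_mem_seg hκ hl).2 hav hbv (s.coreIn_mem l) (s.coreOut_mem l)
    (by linarith) hab (by linarith [s.core_length hκ l]) h1 h2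
  exact s.isWeaklyStable.smul_axis_eq hx hy hxy

/-- The path of a word is on its `l`-th axis only near the `l`-th core. -/
theorem dist_base_of_mem_coreAxis (s : IsTransverseAt T g h p) (hκ : ∀ n, 60 ≤ κ n) {l n : ℕ}
    (hl : l < n) {z : T} (hz : z ∈ seg p (pathElt g h κ n • p)) (hzl : z ∈ coreAxis T g h κ l) :
    dist p (coreIn g h p κ l) - 13 * tl T h ≤ dist p z ∧
      dist p z ≤ dist p (coreOut g h p κ l) + 13 * tl T h := by
  have hτ := s.one_le
  have hlen := s.core_length hκ l
  -- The constant is 13 = 11 + 2: beyond it, the axis would cover a gap of at most 11τ and more than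
  -- τ of the neighbouring core, and so equal the neighbouring axis. At the ends of the path no
  -- neighbour is needed, as the outer pieces have length at most 6τ and 5τ.
  constructor
  · by_contra! hc
    cases l with
    | zero => linarith [s.dist_base_coreIn_zero (κ := κ), dist_nonneg (x := p) (y := z)]
    | succ l =>
      have hlen' := s.core_length hκ l
      obtain ⟨g1, g2⟩ := s.dist_base_coreIn_succ hκ l
      exact s.coreAxis_succ_ne l (s.smul_axis_eq_coreAxis hκ (l := l) (by omega) hz
        (s.core_mem_seg hκ hl).1 hzl (s.coreIn_mem (l + 1)) (by linarith) (by linarith)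
        (by linarith)).symm
  · by_contra! hc
    by_cases hn : n = l + 1
    · subst hn
      have h1 := s.dist_base_end hκ l
      have h2 : dist p z + dist z _ = _ := hz
      linarith [dist_nonneg (x := z) (y := pathElt g h κ (l + 1) • p)]
    · have hlen' := s.core_length hκ (l + 1)
      obtain ⟨g1, g2⟩ := s.dist_base_coreIn_succ hκ l
      exact s.coreAxis_succ_ne l (s.smul_axis_eq_coreAxis hκ (l := l + 1) (by omega)
        (s.core_mem_seg hκ hl).2 hz (s.coreOut_mem l) hzl (by linarith) (by linarith)
        (by linarith))

/-- A translate of `A(h)` that overlaps the path of a word in a long segment is one of the axes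
along which the path runs. -/
theorem exists_coreAxis_eq (s : IsTransverseAt T g h p) (hκ : ∀ n, 60 ≤ κ n) {n : ℕ}
    {v : G} {a b : T}
    (ha : a ∈ seg p (pathElt g h κ n • p)) (hb : b ∈ seg p (pathElt g h κ n • p))
    (hav : a ∈ v • axis T h) (hbv : b ∈ v • axis T h) (hab : 22 * tl T h ≤ dist a b) :
    ∃ l < n, v • axis T h = coreAxis T g h κ l := by
  have hτ := s.one_le
  wlog hle : dist p a ≤ dist p b generalizing a b
  · exact this hb ha hbv hav (by rwa [dist_comm]) (by linarith)
  rw [dist_eq_abs_of_mem_seg s.isRealTree ha hb, abs_of_nonpos (by linarith)] at hab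
  by_contra! hc
  -- If no axis matches, a core that begins by a + 20τ must end by a + τ, so the next one begins by
  -- a + 12τ. Inductively the whole path ends by a + 6τ, before reaching b.
  have step : ∀ l < n, dist p (coreIn g h p κ l) ≤ dist p a + 20 * tl T h →
      dist p (coreOut g h p κ l) ≤ dist p a + tl T h := by
    intro l hl h1
    by_contra! h2
    exact hc l hl (s.smul_axis_eq_coreAxis hκ hl ha hb hav hbv (by linarith) h2 (by linarith))
  have all : ∀ l < n, dist p (coreIn g h p κ l) ≤ dist p a + 20 * tl T h := by
    intro l
    induction l with
    | zero =>
      intro _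
      linarith [s.dist_base_coreIn_zero (κ := κ), dist_nonneg (x := p) (y := a)]
    | succ l ih =>
      intro hl
      linarith [step l (by omega) (ih (by omega)), (s.dist_base_coreIn_succ hκ l).2]
  have hb2 : dist p b + dist b _ = _ := hb
  cases n with
  | zero =>
    simp only [pathElt, one_smul, dist_self] at hb2
    linarith [dist_nonneg (x := p) (y := a), dist_nonneg (x := b) (y := p)]
  | succ n =>
    rw [s.dist_base_end hκ] at hb2
    linarith [step n (by omega) (all n (by omega)),
      dist_nonneg (x := b) (y := pathElt g h κ (n + 1) • p)]

/-- A core well inside the overlap of two paths is matched with a core of the other path, of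
almost the same length. -/
theorem exists_core_match (s : IsTransverseAt T g h p) {κ' : ℕ → ℕ} (hκ : ∀ n, 60 ≤ κ n)
    (hκ' : ∀ n, 60 ≤ κ' n) {n n' l : ℕ} (hl : l < n) {f : G} {a b : T}
    (ha : a ∈ seg p (pathElt g h κ n • p)) (hb : b ∈ seg p (pathElt g h κ n • p))
    (ha' : f⁻¹ • a ∈ seg p (pathElt g h κ' n' • p))
    (hb' : f⁻¹ • b ∈ seg p (pathElt g h κ' n' • p))
    (hal : dist p a + 13 * tl T h < dist p (coreIn g h p κ l))
    (hbl : dist p (coreOut g h p κ l) + 13 * tl T h < dist p b) :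
    ∃ l' < n', coreAxis T g h κ l = f • coreAxis T g h κ' l' ∧
      (κ l : ℤ) ≤ κ' l' + 26 ∧ (κ' l' : ℤ) ≤ κ l + 26 ∧
      f • coreIn g h p κ' l' ∈ seg p (pathElt g h κ n • p) ∧
      f • coreOut g h p κ' l' ∈ seg p (pathElt g h κ n • p) := by
  have hT := s.isRealTree
  have hτ := s.one_le
  have hlen := s.core_length hκ l
  have hlen2 := s.dist_coreIn_coreOut hκ l
  have hI := (s.core_mem_seg hκ hl).1
  have hO := (s.core_mem_seg hκ hl).2
  have hIab : coreIn g h p κ l ∈ seg a b :=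
    mem_seg_of_dist_le hT ha hb hI (by linarith) (by linarith)
  have hOab : coreOut g h p κ l ∈ seg a b :=
    mem_seg_of_dist_le hT ha hb hO (by linarith) (by linarith)
  have hI' := (smul_mem_seg_iff f⁻¹).2 hIab
  have hO' := (smul_mem_seg_iff f⁻¹).2 hOab
  have hIS' := seg_subset_seg hT ha' hb' hI'
  have hOS' := seg_subset_seg hT ha' hb' hO'
  have hIA : f⁻¹ • coreIn g h p κ l ∈ f⁻¹ • coreAxis T g h κ l :=
    Set.smul_mem_smul_set (s.coreIn_mem l)
  have hOA : f⁻¹ • coreOut g h p κ l ∈ f⁻¹ • coreAxis T g h κ l :=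
    Set.smul_mem_smul_set (s.coreOut_mem l)
  have hκl : (60 : ℝ) ≤ κ l := by exact_mod_cast hκ l
  obtain ⟨l', hl', hax⟩ : ∃ l' < n', f⁻¹ • coreAxis T g h κ l = coreAxis T g h κ' l' := by
    have := s.exists_coreAxis_eq hκ' (v := f⁻¹ * (pathElt g h κ l * g)) hIS' hOS'
      (by rw [mul_smul]; exact hIA) (by rw [mul_smul]; exact hOA)
      (by rw [dist_smul, hlen2]; nlinarith)
    simpa only [coreAxis, mul_smul] using this
  have hIA' : f⁻¹ • coreIn g h p κ l ∈ coreAxis T g h κ' l' := hax ▸ hIA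
  have hOA' : f⁻¹ • coreOut g h p κ l ∈ coreAxis T g h κ' l' := hax ▸ hOA
  have hax' : coreAxis T g h κ l = f • coreAxis T g h κ' l' := by rw [← hax, smul_inv_smul]
  -- A point of the matched axis on the second path but outside the overlap would put a or b on the
  -- axis of the core. Both are more than 13τ away from the core, contrary to
  -- `dist_base_of_mem_coreAxis`.
  have hsub : ∀ e ∈ coreAxis T g h κ' l', e ∈ seg p (pathElt g h κ' n' • p) →
      f • e ∈ seg a b := by
    intro e he heS
    have conv : seg (f⁻¹ • coreIn g h p κ l) e ⊆ coreAxis T g h κ' l' :=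
      seg_subset_smul_axis hT _ _ hIA' _ he
    rcases mem_seg_or_mem_seg hT ha' hb' hI' heS with h | h | h
    · simpa using (smul_mem_seg_iff f).2 h
    · have h2 := conv h
      rw [← hax] at h2
      have := (s.dist_base_of_mem_coreAxis hκ hl ha (Set.smul_mem_smul_set_iff.1 h2)).1
      linarith
    · have h2 := conv h
      rw [← hax] at h2
      have := (s.dist_base_of_mem_coreAxis hκ hl hb (Set.smul_mem_smul_set_iff.1 h2)).2
      linarith
  have hab := seg_subset_seg hT ha hb
  have hfI := hab (hsub _ (s.coreIn_mem l') (s.core_mem_seg hκ' hl').1)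
  have hfO := hab (hsub _ (s.coreOut_mem l') (s.core_mem_seg hκ' hl').2)
  have cancel : ∀ a b : ℕ, ((a : ℝ) - 10) * tl T h ≤ (b - 10) * tl T h + 26 * tl T h →
      (a : ℤ) ≤ b + 26 := by
    intro a b hab
    have : (a : ℝ) - 10 ≤ b - 10 + 26 := by
      rw [← add_mul] at hab
      exact le_of_mul_le_mul_right hab (by linarith)
    have h2 : (a : ℝ) ≤ b + 26 := by linarith
    exact_mod_cast h2
  have bound : ∀ {x y u v c : ℝ}, u - c ≤ x → x ≤ v + c → u - c ≤ y → y ≤ v + c →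
      |x - y| ≤ (v - u) + 2 * c := by
    intro x y u v c h1 h2 h3 h4
    rw [abs_le]
    constructor <;> linarith
  -- Each core lies within 13τ of the other at either end, whence 26 = 2 · 13; the argument is run
  -- in both directions.
  refine ⟨l', hl', hax', ?_, ?_, hfI, hfO⟩
  · apply cancel
    have n1 := s.dist_base_of_mem_coreAxis hκ' hl' hIS' hIA'
    have n2 := s.dist_base_of_mem_coreAxis hκ' hl' hOS' hOA'
    have := bound n1.1 n1.2 n2.1 n2.2
    rw [← dist_eq_abs_of_mem_seg hT hIS' hOS', dist_smul, hlen2] at this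
    linarith [s.dist_base_coreOut hκ' l']
  · apply cancel
    have n1 := s.dist_base_of_mem_coreAxis hκ hl hfI
      (hax' ▸ Set.smul_mem_smul_set (s.coreIn_mem l'))
    have n2 := s.dist_base_of_mem_coreAxis hκ hl hfO
      (hax' ▸ Set.smul_mem_smul_set (s.coreOut_mem l'))
    have := bound n1.1 n1.2 n2.1 n2.2
    rw [← dist_eq_abs_of_mem_seg hT hfI hfO, dist_smul, s.dist_coreIn_coreOut hκ'] at this
    linarith [s.dist_base_coreOut hκ l]

end IsTransverseAt

end Path

/-! ### Long overlaps and translation lengths. -/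

section Overlap

variable {G : Type*} [Group G] {T : Type*} [MetricSpace T] [MulAction G T] [IsIsometricSMul G T]
variable {g h : G} {p : T} {κ : ℕ → ℕ}

namespace IsTransverseAt

/-- An element that maps two consecutive cores into the same axes and the same path fixes the
first of these axes pointwise. -/
theorem smul_eq_self_of_core (s : IsTransverseAt T g h p) (hκ : ∀ n, 60 ≤ κ n) {l n : ℕ}
    (hl : l + 1 < n) {f : G}
    (h1 : f • coreIn g h p κ l ∈ seg p (pathElt g h κ n • p))
    (h2 : f • coreOut g h p κ l ∈ seg p (pathElt g h κ n • p))
    (h4 : f • coreOut g h p κ (l + 1) ∈ seg p (pathElt g h κ n • p))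
    (hA : coreAxis T g h κ l = f • coreAxis T g h κ l)
    (hA' : coreAxis T g h κ (l + 1) = f • coreAxis T g h κ (l + 1)) :
    ∀ v ∈ coreAxis T g h κ l, f • v = v := by
  have hT := s.isRealTree
  have hτ := s.one_le
  have c1 := (s.core_mem_seg hκ (show l < n by omega)).1
  have c2 := (s.core_mem_seg hκ (show l < n by omega)).2
  have c4 := (s.core_mem_seg hκ hl).2
  have m1 : f • coreIn g h p κ l ∈ coreAxis T g h κ l := by
    rw [hA]; exact Set.smul_mem_smul_set (s.coreIn_mem l)
  have m2 : f • coreOut g h p κ l ∈ coreAxis T g h κ l := by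
    rw [hA]; exact Set.smul_mem_smul_set (s.coreOut_mem l)
  have m4 : f • coreOut g h p κ (l + 1) ∈ coreAxis T g h κ (l + 1) := by
    rw [hA']; exact Set.smul_mem_smul_set (s.coreOut_mem (l + 1))
  obtain ⟨n1, n1'⟩ := s.dist_base_of_mem_coreAxis hκ (show l < n by omega) h1 m1
  obtain ⟨n2, n2'⟩ := s.dist_base_of_mem_coreAxis hκ (show l < n by omega) h2 m2
  obtain ⟨n4, n4'⟩ := s.dist_base_of_mem_coreAxis hκ hl h4 m4
  have len := s.core_length hκ l
  have len' := s.core_length hκ (l + 1)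
  have gap := (s.dist_base_coreIn_succ hκ l).1
  have d12 := dist_eq_abs_of_mem_seg hT h1 h2
  have d14 := dist_eq_abs_of_mem_seg hT h1 h4
  have d24 := dist_eq_abs_of_mem_seg hT h2 h4
  rw [dist_smul, dist_eq_abs_of_mem_seg hT c1 c2] at d12
  rw [dist_smul, dist_eq_abs_of_mem_seg hT c1 c4] at d14
  rw [dist_smul, dist_eq_abs_of_mem_seg hT c2 c4] at d24
  rw [abs_of_nonpos (by linarith)] at d12 d14 d24
  have e1 := dist_eq_abs_of_mem_seg hT c1 h1
  have e2 := dist_eq_abs_of_mem_seg hT c2 h2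
  have e4 := dist_eq_abs_of_mem_seg hT c4 h4
  -- The image of the next core stays ahead of the first axis's core. If f reversed that core, the
  -- distances to this third point would be in the wrong order.
  have hord : dist p (f • coreOut g h p κ l) - dist p (f • coreIn g h p κ l) =
      dist p (coreOut g h p κ l) - dist p (coreIn g h p κ l) := by
    rcases abs_choice
      (dist p (f • coreIn g h p κ l) - dist p (f • coreOut g h p κ l)) with q | q
    · rw [q] at d12
      rw [abs_of_nonpos (by linarith)] at d24
      rcases abs_choice
        (dist p (f • coreIn g h p κ l) - dist p (f • coreOut g h p κ (l + 1))) with q' | q' <;>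
      rw [q'] at d14 <;> linarith
    · rw [q] at d12
      linarith
  rw [abs_of_nonpos (by linarith)] at d14
  -- f shifts the core along the geodesic without changing its length, so the lower bound at its
  -- start and the upper bound at its end control both endpoints.
  have b1 : dist (coreIn g h p κ l) (f • coreIn g h p κ l) ≤ 13 * tl T h := by
    rw [e1, abs_le]; constructor <;> linarith
  have b2 : dist (coreOut g h p κ l) (f • coreOut g h p κ l) ≤ 13 * tl T h := by
    rw [e2, abs_le]; constructor <;> linarith
  have b4 : dist (coreOut g h p κ (l + 1)) (f • coreOut g h p κ (l + 1)) ≤ 13 * tl T h := by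
    rw [e4, abs_le]; constructor <;> linarith
  have len12 := dist_eq_abs_of_mem_seg hT c1 c2
  rw [abs_of_nonpos (by linarith)] at len12
  -- Translating by u⁻¹ turns the two consecutive axes into A(h) and gA(h).
  set u := pathElt g h κ (l + 1) with hu
  have hκ' := hκ (l + 1)
  have hκr : (60 : ℝ) ≤ κ (l + 1) := by exact_mod_cast hκ'
  have hz : u⁻¹ • coreOut g h p κ (l + 1) = g • h ^ ((κ (l + 1) : ℤ) - 5) • p := by
    rw [coreOut, inv_smul_smul]
  have hw : g • h ^ (4 : ℤ) • p ∈ seg (g • p) (u⁻¹ • coreOut g h p κ (l + 1)) := by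
    rw [hz, smul_mem_seg_iff]
    simpa using zpow_smul_mem_seg hT hτ s.mem_axis (a := 0) (b := 4)
      (c := (κ (l + 1) : ℤ) - 5) (by omega)
  have hwd : dist (u⁻¹ • coreOut g h p κ (l + 1)) (g • h ^ (4 : ℤ) • p) =
      (κ (l + 1) - 9) * tl T h := by
    rw [hz, dist_smul, dist_zpow_smul hT hτ s.mem_axis]
    push_cast
    rw [abs_of_nonneg (by linarith)]
    ring
  have hsm : ∀ x : T, (u⁻¹ * f * u) • u⁻¹ • x = u⁻¹ • f • x := fun x => by
    simp only [mul_smul, smul_inv_smul]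
  have hAu : u⁻¹ • coreAxis T g h κ l = axis T h := by rw [coreAxis_eq, inv_smul_smul]
  have hAu' : u⁻¹ • coreAxis T g h κ (l + 1) = g • axis T h := by
    rw [coreAxis, mul_smul, inv_smul_smul]
  have key := s.smul_eq_self_of_dist_le (e := u⁻¹ * f * u) (y := u⁻¹ • coreIn g h p κ l)
    (y' := u⁻¹ • coreOut g h p κ l) (z := u⁻¹ • coreOut g h p κ (l + 1)) ?_
    (hAu ▸ Set.smul_mem_smul_set (s.coreIn_mem l)) (hAu ▸ Set.smul_mem_smul_set (s.coreOut_mem l))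
    (hAu' ▸ Set.smul_mem_smul_set (s.coreOut_mem (l + 1))) ?_ (by rwa [hsm, dist_smul])
    (by rwa [hsm, dist_smul]) (by rw [dist_smul]; linarith) hw ?_
  · intro v hv
    have := key (u⁻¹ • v) (hAu ▸ Set.smul_mem_smul_set hv)
    rw [hsm] at this
    exact smul_left_cancel _ this
  · rw [← hAu, smul_smul, mul_inv_cancel_right, mul_smul, ← hA]
  · rw [hsm, ← hAu']
    exact Set.smul_mem_smul_set m4
  · rw [seg_comm] at hw ⊢
    refine mem_seg_of_dist_lt hT hw ?_
    rw [hwd, hsm, dist_smul]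
    have := dist_nonneg (x := u⁻¹ • f • coreOut g h p κ (l + 1)) (y := g • h ^ (4 : ℤ) • p)
    nlinarith

/-- A core with the gap after it has length at most Lτ. The first core starting past a + 13τ
therefore starts by a + (13 + L)τ, and its successor ends by a + (2 + 3L)τ, which leaves the margin
of 13τ before b. -/
theorem exists_consecutive_cores (s : IsTransverseAt T g h p) (hκ : ∀ n, 60 ≤ κ n) {L : ℕ}
    (hL : ∀ n, κ n + 1 ≤ L) {n : ℕ} {a b : T} (hb : b ∈ seg p (pathElt g h κ n • p))
    (hab : dist p a + (30 + 3 * L) * tl T h ≤ dist p b) :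
    ∃ l, l + 1 < n ∧ dist p a + 13 * tl T h < dist p (coreIn g h p κ l) ∧
      dist p (coreOut g h p κ (l + 1)) + 13 * tl T h < dist p b := by
  have hτ := s.one_le
  have hlen : ∀ l, dist p (coreOut g h p κ l) ≤ dist p (coreIn g h p κ l) + (L - 11) * tl T h := by
    intro l
    rw [s.dist_base_coreOut hκ]
    have : (κ l : ℝ) + 1 ≤ L := by exact_mod_cast hL l
    nlinarith
  have hstep : ∀ l, dist p (coreIn g h p κ (l + 1)) ≤ dist p (coreIn g h p κ l) + L * tl T h := by
    intro l
    linarith [hlen l, (s.dist_base_coreIn_succ hκ l).2]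
  have hL0 : (61 : ℝ) ≤ L := by exact_mod_cast (Nat.succ_le_succ (hκ 0)).trans (hL 0)
  have hLτ : 61 * tl T h ≤ L * tl T h := mul_le_mul_of_nonneg_right hL0 (by linarith)
  have hz := s.dist_base_coreIn_zero (κ := κ)
  have ha0 : 0 ≤ dist p a := dist_nonneg
  have hbe : dist p b ≤ dist p (pathElt g h κ n • p) := by
    have : dist p b + dist b _ = _ := hb
    linarith [dist_nonneg (x := b) (y := pathElt g h κ n • p)]
  have hex : ∃ l, l + 1 < n ∧ dist p a + 13 * tl T h < dist p (coreIn g h p κ l) := by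
    by_contra! hc
    match n with
    | 0 =>
      simp only [pathElt, one_smul, dist_self] at hbe
      nlinarith
    | 1 =>
      rw [s.dist_base_end hκ] at hbe
      linarith [hlen 0]
    | k + 2 =>
      rw [s.dist_base_end hκ] at hbe
      linarith [hlen (k + 1), hstep k, hc k (by omega)]
  classical
  obtain ⟨hn, hl⟩ := Nat.find_spec hex
  have hmin := fun k => Nat.find_min hex (m := k)
  revert hn hl hmin
  generalize Nat.find hex = l
  intro hn hl hmin
  have hup : dist p (coreIn g h p κ l) ≤ dist p a + (13 + L) * tl T h := by
    cases l with
    | zero => linarith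
    | succ l =>
      have := hmin l (by omega)
      push Not at this
      linarith [this (by omega), hstep l]
  exact ⟨l, hn, hl, by linarith [hlen (l + 1), hstep l]⟩

/-- A long overlap of two paths determines the indices and the position, and the element that
produces it fixes an axis pointwise. -/
theorem exists_fixed_axis_of_overlap (s : IsTransverseAt T g h p) {ι : Type*} {κ : ι → ℕ → ℕ}
    {n L : ℕ} (hκ : ∀ i l, 60 ≤ κ i l) (hL : ∀ i l, κ i l + 1 ≤ L)
    (hsep : ∀ i j, ∀ l < n, ∀ l' < n, (κ i l : ℤ) ≤ κ j l' + 26 → (κ j l' : ℤ) ≤ κ i l + 26 →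
      i = j ∧ l = l') {i j : ι} {f : G} {a b : T}
    (ha : a ∈ seg p (pathElt g h (κ i) n • p) ∩ f • seg p (pathElt g h (κ j) n • p))
    (hb : b ∈ seg p (pathElt g h (κ i) n • p) ∩ f • seg p (pathElt g h (κ j) n • p))
    (hab : (30 + 3 * L) * tl T h ≤ dist a b) :
    i = j ∧ ∃ l < n, ∀ v ∈ coreAxis T g h (κ i) l, f • v = v := by
  have hT := s.isRealTree
  wlog hle : dist p a ≤ dist p b generalizing a b
  · exact this hb ha (by rwa [dist_comm]) (by linarith)
  rw [dist_eq_abs_of_mem_seg hT ha.1 hb.1, abs_of_nonpos (by linarith)] at hab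
  have hτ := s.one_le
  have ha' := Set.mem_smul_set_iff_inv_smul_mem.1 ha.2
  have hb' := Set.mem_smul_set_iff_inv_smul_mem.1 hb.2
  obtain ⟨l, hl, hal, hbl⟩ := s.exists_consecutive_cores (hκ i) (hL i) hb.1 (a := a)
    (by linarith)
  have len := s.core_length (hκ i) l
  have len' := s.core_length (hκ i) (l + 1)
  have gap := (s.dist_base_coreIn_succ (hκ i) l).1
  obtain ⟨l1, hl1, hA, k1, k2, hI, hO⟩ := s.exists_core_match (hκ i) (hκ j)
    (show l < n by omega) ha.1 hb.1 ha' hb' hal (by linarith)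
  obtain ⟨l2, hl2, hA2, k3, k4, -, hO2⟩ := s.exists_core_match (hκ i) (hκ j)
    hl ha.1 hb.1 ha' hb' (by linarith) hbl
  obtain ⟨rfl, rfl⟩ := hsep i j l (by omega) l1 hl1 k1 k2
  obtain ⟨-, rfl⟩ := hsep i i (l + 1) hl l2 hl2 k3 k4
  exact ⟨rfl, l, by omega, s.smul_eq_self_of_core (hκ i) hl hI hO hO2 hA hA2⟩

theorem dist_pathElt_le (s : IsTransverseAt T g h p) {L : ℕ} (hL : ∀ n, κ n + 1 ≤ L) (n : ℕ) :
    dist p (pathElt g h κ n • p) ≤ n * L * tl T h := by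
  have hτ := s.one_le
  induction n with
  | zero => simp [pathElt]
  | succ n ih =>
    have t1 := dist_triangle p (pathElt g h κ n • p) (pathElt g h κ (n + 1) • p)
    have t2 := dist_triangle p (g • p) (g • h ^ κ n • p)
    rw [dist_smul, dist_pow_smul s.isRealTree hτ s.mem_axis] at t2
    rw [pathElt, mul_assoc, mul_smul, dist_smul, mul_smul] at t1
    have : (κ n : ℝ) + 1 ≤ L := by exact_mod_cast hL n
    have h4 : ((κ n : ℝ) + 1) * tl T h ≤ L * tl T h :=
      mul_le_mul_of_nonneg_right this (by linarith)
    have := s.dist_le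
    rw [pathElt, mul_assoc, mul_smul, mul_smul]
    push_cast
    linarith

theorem le_dist_pathElt (s : IsTransverseAt T g h p) (hκ : ∀ n, 60 ≤ κ n) {M : ℕ}
    (hM : ∀ n, M ≤ κ n) (n : ℕ) :
    n * (M - 10) * tl T h ≤ dist p (pathElt g h κ n • p) := by
  have hτ := s.one_le
  have h1 : ∀ l, ((M : ℝ) - 10) * tl T h ≤ (κ l - 10) * tl T h := fun l => by
    have : (M : ℝ) ≤ κ l := by exact_mod_cast hM l
    exact mul_le_mul_of_nonneg_right (by linarith) (by linarith)
  have key : ∀ l : ℕ, ((l : ℝ) + 1) * (M - 10) * tl T h ≤ dist p (coreOut g h p κ l) := by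
    intro l
    induction l with
    | zero =>
      rw [s.dist_base_coreOut hκ]
      have := h1 0
      have := dist_nonneg (x := p) (y := coreIn g h p κ 0)
      push_cast
      linarith
    | succ l ih =>
      rw [s.dist_base_coreOut hκ]
      have := h1 (l + 1)
      have := (s.dist_base_coreIn_succ hκ l).1
      push_cast
      linarith
  cases n with
  | zero => simp
  | succ n =>
    rw [s.dist_base_end hκ]
    have := key n
    push_cast
    linarith

/-- Powers of W are prefixes of the periodic word, so d(p, Wⁿp) grows at least at the stated rate
per power. A point v of smaller displacement would bound this growth by n · d(v, Wv) + 2d(p, v), a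
contradiction for large n. -/
theorem le_tl_pathElt (s : IsTransverseAt T g h p) (hκ : ∀ n, 60 ≤ κ n) {M q : ℕ}
    (hM : ∀ n, M ≤ κ n) (hq : ∀ n, κ (q + n) = κ n) :
    q * (M - 10) * tl T h ≤ tl T (pathElt g h κ q) := by
  have : Nonempty T := ⟨p⟩
  refine le_ciInf fun v => ?_
  set W := pathElt g h κ q with hW
  have hpow : ∀ n : ℕ, dist v (W ^ n • v) ≤ n * dist v (W • v) := by
    intro n
    induction n with
    | zero => simp
    | succ n ih =>
      have := dist_triangle v (W ^ n • v) (W ^ (n + 1) • v)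
      rw [pow_succ, mul_smul, dist_smul] at this
      rw [pow_succ, mul_smul]
      push_cast
      linarith
  by_contra! hlt
  obtain ⟨n, hn⟩ := exists_nat_gt (2 * dist p v / (q * (M - 10) * tl T h - dist v (W • v)))
  rw [div_lt_iff₀ (by linarith)] at hn
  have h1 := s.le_dist_pathElt hκ hM (n * q)
  rw [pathElt_mul_period g h hq] at h1
  have h2 := dist_triangle4 p v (W ^ n • v) (W ^ n • p)
  rw [dist_smul, dist_comm v p] at h2
  push_cast at h1
  have := hpow n
  linarith

end IsTransverseAt

end Overlap

/-! ### The choice of exponents. -/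

section Exponents

/-- Exponents that differ pairwise by at least `27`, with period `q` in the last argument. -/
def exponent (M q i l : ℕ) : ℕ := M + 27 * (i * q + l % q)

theorem exponent_add_period (M q i l : ℕ) : exponent M q i (q + l) = exponent M q i l := by
  simp [exponent]

/-- A multiple of 27 of absolute value at most 26 is zero, and i * q + l determines i and l by
division with remainder. -/
theorem exponent_separated {M q i j l l' : ℕ} (hl : l < q) (hl' : l' < q)
    (h1 : (exponent M q i l : ℤ) ≤ exponent M q j l' + 26)
    (h2 : (exponent M q j l' : ℤ) ≤ exponent M q i l + 26) : i = j ∧ l = l' := by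
  rw [exponent, exponent, Nat.mod_eq_of_lt hl, Nat.mod_eq_of_lt hl'] at *
  have h : i * q + l = j * q + l' := by omega
  have hi : i = j := by
    have e1 : (i * q + l) / q = i := by
      rw [mul_comm, Nat.mul_add_div (by omega), Nat.div_eq_of_lt hl, add_zero]
    have e2 : (j * q + l') / q = j := by
      rw [mul_comm, Nat.mul_add_div (by omega), Nat.div_eq_of_lt hl', add_zero]
    rw [← e1, ← e2, h]
  subst hi
  exact ⟨rfl, by omega⟩

theorem le_exponent (M q i l : ℕ) : M ≤ exponent M q i l := Nat.le_add_right _ _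

theorem exponent_lt {M q i l m : ℕ} (hi : i < m) (hq : 0 < q) :
    exponent M q i l + 1 ≤ M + 27 * (m * q) := by
  have h1 : l % q < q := Nat.mod_lt _ hq
  have h2 : (i + 1) * q ≤ m * q := Nat.mul_le_mul_right _ hi
  rw [add_mul] at h2
  rw [exponent]
  omega

end Exponents

/-! ### Verification of small cancellation. -/

section SmallCancellation

variable {G : Type*} [Group G] {T : Type*} [MetricSpace T] [MulAction G T] {g h : G} {p : T}

theorem eq_one_of_fixes_coreAxis {κ : ℕ → ℕ} {l : ℕ} {f : G}
    (hK : K T h = ⊥) (hf : ∀ v ∈ coreAxis T g h κ l, f • v = v) : f = 1 := by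
  set u := pathElt g h κ l * g
  have h1 : u⁻¹ * f * u ∈ K T h := by
    rw [K, mem_fixingSubgroup_iff]
    intro v hv
    rw [mul_smul, mul_smul, hf _ (Set.smul_mem_smul_set hv), inv_smul_smul]
  rw [hK, Subgroup.mem_bot] at h1
  have : u⁻¹ * f = u⁻¹ := by rw [← mul_eq_one_iff_eq_inv, h1]
  simpa using this

variable [IsIsometricSMul G T]

/-- The diameter need not be attained, hence the strict slack between D and R. -/
theorem exists_pair_of_le_length {S : Set T} {R D : ℝ} (hD : 0 ≤ D) (hDR : D < R)
    (h : ENNReal.ofReal R ≤ length S) : ∃ a ∈ S, ∃ b ∈ S, D ≤ dist a b := by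
  by_contra! hc
  have h1 : length S ≤ ENNReal.ofReal D := Metric.ediam_le fun x hx y hy => by
    rw [edist_dist]
    exact ENNReal.ofReal_le_ofReal (hc x hx y hy).le
  exact absurd (h.trans h1) (not_le.2 ((ENNReal.ofReal_lt_ofReal_iff_of_nonneg hD).2 hDR))

/-- If y and fy both lie on the geodesic, they have the same distances to the two endpoints of a
core, which f fixes; so they coincide. -/
theorem IsTransverseAt.smul_eq_self_of_mem_overlap (s : IsTransverseAt T g h p) {κ : ℕ → ℕ}
    (hκ : ∀ n, 60 ≤ κ n) {l n : ℕ} (hl : l < n) {f : G}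
    (hf : ∀ v ∈ coreAxis T g h κ l, f • v = v) {x : T}
    (hx : x ∈ seg p (pathElt g h κ n • p) ∩ f • seg p (pathElt g h κ n • p)) : f • x = x := by
  obtain ⟨hx, y, hy, rfl⟩ := hx
  have e1 := dist_smul f y (coreIn g h p κ l)
  have e2 := dist_smul f y (coreOut g h p κ l)
  rw [hf _ (s.coreIn_mem l)] at e1
  rw [hf _ (s.coreOut_mem l)] at e2
  have := eq_of_dist_eq s.isRealTree hx hy (s.core_mem_seg hκ hl).1 (s.core_mem_seg hκ hl).2
    (s.coreIn_ne_coreOut hκ l) e1 e2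
  exact congrArg (f • ·) this

variable {m n M : ℕ} {N : ℝ}

/-- The quantitative form of small cancellation for the words with exponents `exponent M n i`,
for `n` large compared to `N` and `M` large compared to `n`. -/
theorem IsTransverseAt.smallCancellation (s : IsTransverseAt T g h p) (hN : 1 ≤ N) (hm : 1 ≤ m)
    (hn : 8 * N ≤ n) (hM : N * (27 * (m * n)) + 10 * (N + 1) + 200 ≤ M) {a : Fin m → G}
    (ha : ∀ i, a i = pathElt g h (exponent M n i) n) :
    (IsWeaklySmallCancellationAt N a p ∧ (K T h = ⊥ → IsSmallCancellationAt N a p)) ∧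
      ∀ i, N * tl T h ≤ tl T (a i) := by
  have hτ := s.one_le
  have hm' : (1 : ℝ) ≤ m := by exact_mod_cast hm
  have hn8 : (8 : ℝ) ≤ n := by linarith
  have hn0 : 0 < n := by
    have : (0 : ℝ) < n := by linarith
    exact_mod_cast this
  have hmn : (0 : ℝ) ≤ m * n := by positivity
  have hmnN : (m * n : ℝ) ≤ N * (m * n) := le_mul_of_one_le_left hmn hN
  have hM200 : (200 : ℝ) ≤ M := by nlinarith
  have hMnat : 200 ≤ M := by exact_mod_cast hM200
  have h60 : ∀ (i : Fin m) l, 60 ≤ exponent M n i l := fun i l =>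
    le_trans (by omega) (le_exponent M n i l)
  set L := M + 27 * (m * n) with hL
  have hLr : (L : ℝ) = M + 27 * (m * n) := by rw [hL]; push_cast; ring
  have hexp : ∀ (i : Fin m) l, exponent M n i l + 1 ≤ L := fun i l => exponent_lt i.2 hn0
  have htl : ∀ i, n * (M - 10) * tl T h ≤ tl T (a i) := fun i => by
    rw [ha]
    exact s.le_tl_pathElt (h60 i) (le_exponent M n i) (exponent_add_period M n i)
  have hNτ : ∀ i, N * tl T h < tl T (a i) := fun i => by
    refine lt_of_lt_of_le ?_ (htl i)
    refine mul_lt_mul_of_pos_right ?_ (by linarith)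
    nlinarith
  have : Nonempty (Fin m) := ⟨⟨0, hm⟩⟩
  have hinf : n * (M - 10) * tl T h ≤ ⨅ i, tl T (a i) := le_ciInf htl
  -- The factor 8 in `hn` absorbs 1 / N and leaves 8(M - 10), which exceeds 30 + 3L because L - M =
  -- 27mn is at most M.
  have hlong : (30 + 3 * L) * tl T h < 1 / N * ⨅ i, tl T (a i) := by
    have h1 : (1 / N) * (n * (M - 10) * tl T h) ≤ 1 / N * ⨅ i, tl T (a i) :=
      mul_le_mul_of_nonneg_left hinf (by positivity)
    refine lt_of_lt_of_le ?_ h1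
    have h2 : 8 ≤ 1 / N * n := by
      rw [one_div, ← div_eq_inv_mul, le_div_iff₀ (by linarith)]
      exact hn
    have h3 : 8 * (M - 10) ≤ 1 / N * n * (M - 10 : ℝ) :=
      mul_le_mul_of_nonneg_right h2 (by linarith)
    have h4 : (30 + 3 * L : ℝ) < 1 / N * n * (M - 10) := by
      refine lt_of_lt_of_le ?_ h3
      rw [hLr]
      linarith
    calc (30 + 3 * L : ℝ) * tl T h < 1 / N * n * (M - 10) * tl T h :=
          mul_lt_mul_of_pos_right h4 (by linarith)
      _ = _ := by ring
  have hover : ∀ (f : G) (i j : Fin m),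
      ENNReal.ofReal (1 / N * ⨅ l, tl T (a l)) ≤
        length (seg p (a i • p) ∩ f • seg p (a j • p)) →
      i = j ∧ ∃ l < n, ∀ v ∈ coreAxis T g h (exponent M n i) l, f • v = v := by
    intro f i j hlen
    obtain ⟨x, hx, y, hy, hxy⟩ := exists_pair_of_le_length (by positivity) hlong hlen
    rw [ha, ha] at hx hy
    exact s.exists_fixed_axis_of_overlap (κ := fun i : Fin m => exponent M n i) h60 hexp
      (fun i j l hl l' hl' h1 h2 => by
        obtain ⟨h3, h4⟩ := exponent_separated hl hl' h1 h2
        exact ⟨Fin.ext h3, h4⟩) hx hy hxy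
  have hweak : IsWeaklySmallCancellationAt N a p := by
    refine ⟨fun i => ?_, fun j => ?_, fun f i j hlen => ?_⟩
    · have h1 := tl_le (a i) p
      have h2 := hNτ i
      nlinarith
    · have h1 := s.dist_pathElt_le (hexp j) n
      rw [← ha] at h1
      refine h1.trans (le_trans ?_ (mul_le_mul_of_nonneg_left hinf (by positivity)))
      -- After clearing N this reads 27Nmn + 10(N + 1) ≤ M, which is where the first two terms of
      -- `hM` come from.
      have h2 : (L : ℝ) ≤ (N + 1) / N * (M - 10) := by
        rw [div_mul_eq_mul_div, le_div_iff₀ (by linarith), hLr]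
        nlinarith
      calc (n * L * tl T h : ℝ) = L * (n * tl T h) := by ring
        _ ≤ (N + 1) / N * (M - 10) * (n * tl T h) := by gcongr
        _ = _ := by ring
    · obtain ⟨rfl, l, hl, hf⟩ := hover f i j hlen
      refine ⟨rfl, fun x hx => ?_⟩
      rw [ha] at hx
      exact s.smul_eq_self_of_mem_overlap (h60 i) hl hf hx
  refine ⟨⟨hweak, fun hK => ⟨hweak, fun f i j hlen => ?_⟩⟩, fun i => (hNτ i).le⟩
  obtain ⟨-, l, -, hf⟩ := hover f i j hlen
  exact eq_one_of_fixes_coreAxis hK hf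

end SmallCancellation

end TreeAction

/-! ### The proposition. -/

theorem propositionl (N : ℝ) (hN : 1 ≤ N) (m : ℕ) (hm : 1 ≤ m) :
    ∃ (n : ℕ) (k : Fin m → Fin n → ℕ), 1 ≤ n ∧ (∀ i j, 1 ≤ k i j) ∧
      ∀ (G : Type*) [Group G] (T : Type*) [MetricSpace T] [MulAction G T] [IsIsometricSMul G T]
        (_ : IsRealTree T) (g h : G),
        IsHyperbolic T h → 1 ≤ tl T h →
        g ∉ E T h →
        MeetCoherently T g h → ¬ InvertsSubsegment T g (axis T h) →
        tl T g ≤ tl T h →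
          (IsStable T h →
            (∀ p ∈ axis T g ∩ axis T h,
              IsSmallCancellationAt N (fun i => evalWord g h (xyWord (k i))) p) ∧
            ∀ i, N * max (tl T g) (tl T h) ≤ tl T (evalWord g h (xyWord (k i)))) ∧
          (IsWeaklyStable T h →
            (∀ p ∈ axis T g ∩ axis T h,
              IsWeaklySmallCancellationAt N (fun i => evalWord g h (xyWord (k i))) p) ∧
            ∀ i, N * max (tl T g) (tl T h) ≤ tl T (evalWord g h (xyWord (k i)))) := by
  have hN0 : (N : ℝ) ≤ ⌈N⌉₊ := Nat.le_ceil N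
  -- Rounding N up turns the two thresholds of `IsTransverseAt.smallCancellation` into natural
  -- numbers that depend only on N and m.
  refine ⟨8 * ⌈N⌉₊, fun i j => exponent (⌈N⌉₊ * (27 * (m * (8 * ⌈N⌉₊))) + 10 * (⌈N⌉₊ + 1) + 200)
    (8 * ⌈N⌉₊) i j, ?_, ?_, ?_⟩
  · have : 0 < ⌈N⌉₊ := Nat.ceil_pos.2 (by linarith)
    omega
  · exact fun i j => le_trans (by omega) (le_exponent _ _ _ _)
  intro G _ T _ _ _ hT g h _ h1 hg hco _ hgh
  set M := ⌈N⌉₊ * (27 * (m * (8 * ⌈N⌉₊))) + 10 * (⌈N⌉₊ + 1) + 200 with hM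
  have hMN : N * (27 * (m * ((8 * ⌈N⌉₊ : ℕ) : ℝ))) + 10 * (N + 1) + 200 ≤ M := by
    rw [hM]
    push_cast
    gcongr
  rw [max_eq_right hgh]
  have main : IsWeaklyStable T h → ∀ p ∈ axis T g ∩ axis T h,
      (IsWeaklySmallCancellationAt N (fun i : Fin m => evalWord g h
          (xyWord fun j : Fin (8 * ⌈N⌉₊) => exponent M (8 * ⌈N⌉₊) i j)) p ∧
        (K T h = ⊥ → IsSmallCancellationAt N (fun i : Fin m => evalWord g h
          (xyWord fun j : Fin (8 * ⌈N⌉₊) => exponent M (8 * ⌈N⌉₊) i j)) p)) ∧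
      ∀ i : Fin m, N * tl T h ≤ tl T (evalWord g h
        (xyWord fun j : Fin (8 * ⌈N⌉₊) => exponent M (8 * ⌈N⌉₊) i j)) := by
    intro hs p hp
    have hp1 : dist p (g • p) = tl T g := hp.1
    have s : IsTransverseAt T g h p := ⟨hT, h1, hs, hg, hp.2, by rw [hp1]; exact hgh⟩
    exact s.smallCancellation hN hm (by push_cast; linarith) hMN
      (fun i => evalWord_xyWord g h (exponent M (8 * ⌈N⌉₊) i) _)
  -- The translation length bound mentions no base point, but its proof needs one; any common point
  -- of the axes serves.
  obtain ⟨p, hp⟩ := hco.1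
  exact ⟨fun hs => ⟨fun q hq => (main hs.1 q hq).1.2 hs.2, (main hs.1 p hp).2⟩,
    fun hs => ⟨fun q hq => (main hs q hq).1.1, (main hs p hp).2⟩⟩
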